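/- **Setting.** In weighted paging there are $n$ pages with positive weights $w(p)$ and a cache that holds at most $k<n$ pages and is initially empty. A finite sequence $\sigma$ of page requests is served one by one; each requested page must be in the cache when it is requested, and evicting a page $p$ from the cache costs $w(p)$. The cost of serving $\sigma$ is the total weight of the evicted pages, and $\mathrm{OPT}(\sigma)$ is the minimum cost over all ways of serving $\sigma$ offline. In the per-request prediction (PRP) model, an online algorithm is told, together with each request, the (correct) time step at which the same page will be requested next, or that it will not be requested again; it decides on the cache contents from the requests and predictions revealed so far. A randomized algorithm is a random deterministic online algorithm. A deterministic (respectively randomized) algorithm is $r$-competitive if there is a constant $b$ such that for every request sequence $\sigma$ its cost (respectively its expected cost) on $\sigma$ is at most $r\cdot\mathrm{OPT}(\sigma)+b$. **Theorem 1.** For weighted paging with PRP, every deterministic online algorithm is $\Omega(k)$-competitive and every randomized online algorithm is $\Omega(\log k)$-competitive. That is, there is an absolute constant $c>0$ such that for all integers $n>k\ge 1$: 1. there are positive page weights such that every deterministic online algorithm with PRP that is $r$-competitive for these weights has $r\ge c\,k$; 2. there are positive page weights such that every randomized online algorithm with PRP that is $r$-competitive (against an oblivious adversary) for these weights has $r\ge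 c\log k$. -/

import Mathlib

open MeasureTheory

universe u

namespace WeightedPaging

/-- The prediction revealed with the request at (0-based) index `t` of the request sequence
`σ`: the time step of the next request of the same page, where time steps are counted from `1`;
it is `⊤` if the page is never requested again. -/
noncomputable def nextRequest {n T : ℕ} (σ : Fin T → Fin n) (t : Fin T) : ℕ∞ :=
  ⨅ (s : Fin T) (_ : t < s) (_ : σ s = σ t), (((s : ℕ) + 1 : ℕ) : ℕ∞)

/-- What the online algorithm sees in one time step: the requested page and its prediction. -/
abbrev Obs (n : ℕ) : Type := Fin n × ℕ∞

/-- The observation made at index `t` when the request sequence is `σ`. -/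
noncomputable def obs {n T : ℕ} (σ : Fin T → Fin n) (t : Fin T) : Obs n :=
  (σ t, nextRequest σ t)

/-- The observations made before index `t`, in chronological order. -/
noncomputable def history {n T : ℕ} (σ : Fin T → Fin n) (t : ℕ) : List (Obs n) :=
  (List.ofFn (obs σ)).take t

/-- Total weight of the pages evicted during the first `T` steps, when `C 0` is the initial cache
and `C (t + 1)` is the cache after step `t + 1`. -/
def evictionCost {n : ℕ} (w : Fin n → ℝ) (T : ℕ) (C : ℕ → Finset (Fin n)) : ℝ :=
  ∑ t ∈ Finset.range T, ∑ p ∈ C t \ C (t + 1), w p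

/-- `C` is a feasible way of serving `σ` with a cache of size `k`, starting from an empty cache:
the cache never holds more than `k` pages, and it holds each requested page when that page is
requested. -/
structure IsSchedule {n T : ℕ} (k : ℕ) (σ : Fin T → Fin n) (C : ℕ → Finset (Fin n)) : Prop where
  empty_start : C 0 = ∅
  card_le : ∀ t, (C t).card ≤ k
  serves : ∀ t : Fin T, σ t ∈ C ((t : ℕ) + 1)

/-- The optimal offline cost of serving `σ` with a cache of size `k`. -/
noncomputable def opt {n T : ℕ} (k : ℕ) (w : Fin n → ℝ) (σ : Fin T → Fin n) : ℝ :=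
  sInf (evictionCost w T '' {C | IsSchedule k σ C})

/-- A deterministic online algorithm for `n` pages and cache size `k` with per-request
predictions: from the past observations and the current one it determines the cache with which
the current request is served. -/
structure DetAlg (n k : ℕ) where
  serve : List (Obs n) → Obs n → Finset (Fin n)
  card_le : ∀ past x, (serve past x).card ≤ k
  mem_serve : ∀ past x, x.1 ∈ serve past x

/-- The cache contents of the algorithm on `σ`: empty at first, and `A.run σ (t + 1)` after the
request at index `t` has been served. Indices above `T` are irrelevant. -/
noncomputable def DetAlg.run {n k T : ℕ} (A : DetAlg n k) (σ : Fin T → Fin n) :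
    ℕ → Finset (Fin n)
  | 0 => ∅
  | t + 1 => if h : t < T then A.serve (history σ t) (obs σ ⟨t, h⟩) else ∅

/-- The cost of a deterministic online algorithm on `σ`. -/
noncomputable def DetAlg.cost {n k T : ℕ} (A : DetAlg n k) (w : Fin n → ℝ)
    (σ : Fin T → Fin n) : ℝ :=
  evictionCost w T (A.run σ)

/-- `A` is `r`-competitive: on every finite request sequence its cost is at most `r` times the
optimal offline cost, up to an additive constant independent of the request sequence. -/
def DetAlg.IsCompetitive {n k : ℕ} (A : DetAlg n k) (w : Fin n → ℝ) (r : ℝ) : Prop :=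
  ∃ b : ℝ, ∀ (T : ℕ) (σ : Fin T → Fin n), A.cost w σ ≤ r * opt k w σ + b

/-- A randomized online algorithm: a random deterministic online algorithm, on an arbitrary
probability space. -/
structure RandAlg (n k : ℕ) where
  Ω : Type u
  [mΩ : MeasurableSpace Ω]
  P : Measure Ω
  [isProb : IsProbabilityMeasure P]
  alg : Ω → DetAlg n k
  measurableSet_serve : ∀ (past : List (Obs n)) (x : Obs n) (C : Finset (Fin n)),
    MeasurableSet {ω | (alg ω).serve past x = C}

/-- The expected cost of a randomized online algorithm on a fixed request sequence `σ`. -/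
noncomputable def RandAlg.expectedCost {n k T : ℕ} (A : RandAlg.{u} n k) (w : Fin n → ℝ)
    (σ : Fin T → Fin n) : ℝ :=
  letI := A.mΩ
  ∫ ω, (A.alg ω).cost w σ ∂A.P

/-- `A` is `r`-competitive against an oblivious adversary: on every finite request sequence its
expected cost is at most `r` times the optimal offline cost, up to an additive constant
independent of the request sequence. -/
def RandAlg.IsCompetitive {n k : ℕ} (A : RandAlg.{u} n k) (w : Fin n → ℝ) (r : ℝ) : Prop :=
  ∃ b : ℝ, ∀ (T : ℕ) (σ : Fin T → Fin n), A.expectedCost w σ ≤ r * opt k w σ + b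

end WeightedPaging

/-! Put `k = K + 1` and use only `K + 2` pages: page `j ≤ K` has weight `2 ^ j`, and page `K + 1`
has weight `1` and closes every day. Hence at the end of each day some page `j ≤ K` is missing from
the cache. Days are organized in nested calendar intervals of lengths `N ^ i`, and page `j` is
requested only at active days divisible by `N ^ j`. A bit per day decides between two continuations.
Either the day opens all intervals starting there, and each requested page `j` returns after exactly
`N ^ j` days; or activity pauses until the end of the next larger interval, where all requested
pages return. In both cases the predictions at day `d` are determined by the bits up to `d`
(`obs_congr`), so they do not help against later bits. Offline, it is good to keep the page of level
`i` missing throughout an interval of level `i`, and which level is best depends on the future bits.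

Deterministic bound, with `N = 4`: the adversary continues exactly when all pages above the level of
the day are cached. In an opened interval of level `i + 1` the algorithm either pays `2 ^ (i + 1)`
on some day or has all children opened (`opens_children`). Thus its cost is at least a quarter of
the total weight of the opened intervals (`sum_numOpened_le`). The `K + 1` offline schedules that
stick to one level cost together at most four times that weight, so the best of them wins a factor
of order `K + 1` (`mul_opt_le_sum_numOpened`).

Randomized bound: the bits are independent and fair. A potential argument shows that any
deterministic algorithm pays on average at least `1` per opening day (`mean_openInd_le_mean_cost`),
which amounts to `(2 - p) ^ K` per top interval, where `p = 2 ^ (1 - N)` is the probability that all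
children of an opened interval are opened. Offline, one uses the maximal intervals with that
property; each costs little more than a single page, and the mean cost obeys a linear recursion
(`mean_treeCost_le`). With `N` about `log₂ K` the ratio is of order `log K`, and averaging over the
bits transfers the bound to randomized algorithms. -/

namespace WeightedPaging

/-! ### A calendar of nested intervals -/

/-- The largest `i ≤ K` such that day `d` starts an interval of length `N ^ i`. -/
def level (N K d : ℕ) : ℕ := Nat.findGreatest (fun i => N ^ i ∣ d) K

section Calendar

variable {N K : ℕ} {D D' : ℕ → Bool} {d e i j x : ℕ}

lemma level_le : level N K d ≤ K := Nat.findGreatest_le K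

lemma pow_level_dvd : N ^ level N K d ∣ d :=
  Nat.findGreatest_spec (P := fun i => N ^ i ∣ d) (Nat.zero_le K) (by simp)

lemma le_level_iff (hj : j ≤ K) : j ≤ level N K d ↔ N ^ j ∣ d :=
  ⟨fun h => (pow_dvd_pow N h).trans pow_level_dvd, fun h => Nat.le_findGreatest hj h⟩

lemma level_lt_iff (hj : j ≤ K) : level N K d < j ↔ ¬ N ^ j ∣ d := by
  rw [← le_level_iff hj, not_le]

lemma level_zero : level N K 0 = K :=
  le_antisymm level_le ((le_level_iff le_rfl).2 (dvd_zero _))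

/-- After an active day `d`, the day `d + 1` is active too. -/
abbrev Continues (N K : ℕ) (D : ℕ → Bool) (d : ℕ) : Prop := D d = true ∨ level N K d = K

/-- The first active day that is not before `d`. If the bit of an active day `d` is `false`, then
the next active day is the end of the smallest calendar interval around `d` that `d` does not
start. -/
def nextActive (N K : ℕ) (D : ℕ → Bool) : ℕ → ℕ
  | 0 => 0
  | d + 1 =>
    if nextActive N K D d = d then
      if Continues N K D d then d + 1
      else (d / N ^ (level N K d + 1) + 1) * N ^ (level N K d + 1)
    else nextActive N K D d

abbrev IsActive (N K : ℕ) (D : ℕ → Bool) (d : ℕ) : Prop := nextActive N K D d = d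

/-- Day `d` opens all calendar intervals which it starts. -/
abbrev Opens (N K : ℕ) (D : ℕ → Bool) (d : ℕ) : Prop := IsActive N K D d ∧ Continues N K D d

lemma nextActive_succ_of_not (h : ¬ IsActive N K D d) :
    nextActive N K D (d + 1) = nextActive N K D d := by
  rw [nextActive, if_neg h]

lemma nextActive_succ_of_opens (h : Opens N K D d) : nextActive N K D (d + 1) = d + 1 := by
  rw [nextActive, if_pos h.1, if_pos h.2]

lemma nextActive_succ_of_stop (h : IsActive N K D d) (hc : ¬ Continues N K D d) :
    nextActive N K D (d + 1) = (d / N ^ (level N K d + 1) + 1) * N ^ (level N K d + 1) := by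
  rw [nextActive, if_pos h, if_neg hc]

lemma lt_next_multiple (m : ℕ) (hm : 0 < m) : d < (d / m + 1) * m := by
  have := Nat.lt_div_mul_add (a := d) hm
  rw [add_mul, one_mul]; exact this

lemma le_nextActive (hN : 0 < N) : ∀ d, d ≤ nextActive N K D d
  | 0 => Nat.zero_le _
  | d + 1 => by
    by_cases h : IsActive N K D d
    · by_cases hc : Continues N K D d
      · rw [nextActive_succ_of_opens ⟨h, hc⟩]
      · rw [nextActive_succ_of_stop h hc]
        exact lt_next_multiple _ (pow_pos hN _)
    · rw [nextActive_succ_of_not h]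
      exact lt_of_le_of_ne (le_nextActive hN d) (Ne.symm h)

/-- Whether day `d` is active is settled before its own bit is read; all arguments that the input is
revealed online rest on this. -/
lemma nextActive_congr (h : ∀ e < d, D e = D' e) : nextActive N K D d = nextActive N K D' d := by
  induction d with
  | zero => rfl
  | succ d ih =>
    rw [nextActive, nextActive, ih fun e he => h e (by omega)]
    simp only [Continues, h d (by omega)]

/-- Nothing happens between a day and the next active day. -/
lemma nextActive_eq_of_le (hde : d ≤ e) (he : e ≤ nextActive N K D d) :
    nextActive N K D e = nextActive N K D d := by
  induction e, hde using Nat.le_induction with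
  | base => rfl
  | succ e hde ih =>
    have := ih (by omega)
    rw [nextActive_succ_of_not (by unfold IsActive; omega), this]

lemma isActive_nextActive (hN : 0 < N) : IsActive N K D (nextActive N K D d) :=
  nextActive_eq_of_le (le_nextActive hN d) le_rfl

lemma level_lt_of_not_continues (hc : ¬ Continues N K D d) : level N K d < K :=
  lt_of_le_of_ne level_le fun h => hc (Or.inr h)

lemma level_lt_level_nextActive (h : IsActive N K D d) (hc : ¬ Continues N K D d) :
    level N K d < level N K (nextActive N K D (d + 1)) := by
  rw [nextActive_succ_of_stop h hc]
  exact (le_level_iff (level_lt_of_not_continues hc)).2 (dvd_mul_left _ _)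

/-- The level does not exceed that of a day at which activity stops until activity resumes. -/
lemma level_le_of_between (h : IsActive N K D d) (hc : ¬ Continues N K D d) (hde : d < e)
    (he : e < nextActive N K D (d + 1)) : level N K e ≤ level N K d := by
  rw [nextActive_succ_of_stop h hc] at he
  by_contra hlt
  push Not at hlt
  obtain ⟨c, hcc⟩ := (le_level_iff (level_lt_of_not_continues hc)).1 hlt
  set m := N ^ (level N K d + 1)
  subst hcc
  rw [mul_comm] at he
  have h1 : c < d / m + 1 := Nat.lt_of_mul_lt_mul_right he
  have h2 : d < c * m := by rwa [mul_comm]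
  have h3 : d / m < c := Nat.div_lt_of_lt_mul (by rwa [mul_comm] at h2)
  omega

/-- A pause never leaves an opened interval: a day strictly inside has level below `i`, so the
interval at whose end activity resumes is nested in the opened one. -/
lemma nextActive_le_of_opens (hx : N ^ i ∣ x) (hi : i ≤ K) (ho : Opens N K D x)
    (hxd : x < d) (hd : d ≤ x + N ^ i) : nextActive N K D d ≤ x + N ^ i := by
  induction d, hxd using Nat.le_induction with
  | base => rw [nextActive_succ_of_opens ho]; exact hd
  | succ d hxd ih =>
    have ih := ih (by omega)
    by_cases h : IsActive N K D d
    · by_cases hc : Continues N K D d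
      · rw [nextActive_succ_of_opens ⟨h, hc⟩]; exact hd
      · rw [nextActive_succ_of_stop h hc]
        have hlt : level N K d < i := by
          rw [level_lt_iff hi]
          intro hdvd
          have h1 : N ^ i ∣ d - x := Nat.dvd_sub hdvd hx
          have := Nat.le_of_dvd (by omega) h1
          omega
        have hdiv : N ^ (level N K d + 1) ∣ x + N ^ i :=
          (pow_dvd_pow N hlt).trans (Nat.dvd_add hx dvd_rfl)
        obtain ⟨c, hcc⟩ := hdiv
        set m := N ^ (level N K d + 1)
        rw [hcc, mul_comm m c]
        have : d / m < c := Nat.div_lt_of_lt_mul (by omega)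
        exact Nat.mul_le_mul_right _ this
    · rw [nextActive_succ_of_not h]; exact ih

lemma isActive_of_opens (hN : 0 < N) (hx : N ^ i ∣ x) (hi : i ≤ K) (ho : Opens N K D x) :
    IsActive N K D (x + N ^ i) :=
  le_antisymm (nextActive_le_of_opens hx hi ho (by have := pow_pos hN i; omega) le_rfl)
    (le_nextActive hN _)

lemma opens_of_level (h : IsActive N K D d) (hl : N ^ K ∣ d) : Opens N K D d :=
  ⟨h, Or.inr (le_antisymm level_le ((le_level_iff le_rfl).2 hl))⟩

/-- Days of level `K` ignore their bit, so the top intervals are independent repetitions of the same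
game; their number makes the additive constant harmless. -/
lemma opens_mul_pow (hN : 0 < N) : ∀ a : ℕ, Opens N K D (a * N ^ K)
  | 0 => opens_of_level (by simp [IsActive, nextActive]) (dvd_mul_left _ _)
  | a + 1 => opens_of_level (by
      rw [add_mul, one_mul]
      exact isActive_of_opens hN (dvd_mul_left _ _) le_rfl (opens_mul_pow hN a)) (dvd_mul_left _ _)

/-- The children of an interval of level `i + 1` start on days of level `i`. -/
lemma level_child (hN : 0 < N) (hi : i < K) (hx : N ^ (i + 1) ∣ x) {b : ℕ} (hb : 1 ≤ b)
    (hbN : b < N) : level N K (x + b * N ^ i) = i := by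
  apply le_antisymm
  · rw [← Nat.lt_succ_iff, level_lt_iff hi]
    intro h
    rw [Nat.dvd_add_right hx, pow_succ, mul_comm] at h
    have := Nat.le_of_dvd (by omega) (Nat.dvd_of_mul_dvd_mul_right (pow_pos hN i) h)
    omega
  · rw [le_level_iff hi.le]
    exact Nat.dvd_add ((pow_dvd_pow N (Nat.le_succ i)).trans hx) (dvd_mul_left _ _)

end Calendar

/-! ### The request sequences -/

section Requests

variable {N K : ℕ} {D D' : ℕ → Bool} {d e i j n s t T : ℕ}

/-- The page requested at index `t`. A day has `K + 2` indices; an active day requests the pages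
up to its level first, and all other requests go to the page `K + 1`. -/
def request (N K : ℕ) (D : ℕ → Bool) (t : ℕ) : ℕ :=
  if IsActive N K D (t / (K + 2)) ∧ t % (K + 2) ≤ level N K (t / (K + 2)) then t % (K + 2)
  else K + 1

lemma request_le : request N K D t ≤ K + 1 := by
  unfold request
  split_ifs
  · exact Nat.lt_succ_iff.1 (Nat.mod_lt _ (by omega))
  · exact le_rfl

lemma slot_div (hs : s < K + 2) : (d * (K + 2) + s) / (K + 2) = d := by
  rw [mul_comm, Nat.mul_add_div (by omega), Nat.div_eq_of_lt hs, add_zero]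

lemma slot_mod (hs : s < K + 2) : (d * (K + 2) + s) % (K + 2) = s := by
  rw [mul_comm, Nat.mul_add_mod, Nat.mod_eq_of_lt hs]

lemma request_slot (hs : s < K + 2) : request N K D (d * (K + 2) + s) =
    if IsActive N K D d ∧ s ≤ level N K d then s else K + 1 := by
  rw [request, slot_div hs, slot_mod hs]

lemma request_slot_of_le (ha : IsActive N K D d) (hs : s ≤ level N K d) :
    request N K D (d * (K + 2) + s) = s := by
  rw [request_slot (by have := level_le (N := N) (K := K) (d := d); omega), if_pos ⟨ha, hs⟩]

lemma request_last : request N K D (d * (K + 2) + (K + 1)) = K + 1 := by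
  rw [request_slot (by omega)]
  split_ifs <;> rfl

lemma request_eq_iff (hj : j ≤ K) : request N K D t = j ↔
    IsActive N K D (t / (K + 2)) ∧ j ≤ level N K (t / (K + 2)) ∧ t % (K + 2) = j := by
  unfold request
  split_ifs with h
  · exact ⟨fun hh => ⟨h.1, hh ▸ h.2, hh⟩, fun hh => hh.2.2⟩
  · exact ⟨fun hh => by omega, fun hh => absurd ⟨hh.1, hh.2.2 ▸ hh.2.1⟩ h⟩

lemma request_congr_of_active (h : ∀ e < t / (K + 2), D e = D' e) :
    request N K D t = request N K D' t := by
  simp only [request, IsActive, nextActive_congr h]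

/-- The request sequence of the first `T` indices. -/
def requests (N : ℕ) (hn : K + 1 < n) (T : ℕ) (D : ℕ → Bool) (t : Fin T) : Fin n :=
  ⟨request N K D t, lt_of_le_of_lt request_le hn⟩

/-! ### Predictions. -/

lemma nextRequest_eq_of_first {σ : Fin T → Fin n} {r : ℕ → ℕ} (hr : ∀ t, (σ t : ℕ) = r t)
    (t : Fin T) (hs : (t : ℕ) < s) (hrs : r s = r t)
    (hfirst : ∀ v, (t : ℕ) < v → v < s → r v ≠ r t) :
    nextRequest σ t = if s < T then ((s + 1 : ℕ) : ℕ∞) else ⊤ := by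
  have hle : ∀ v : Fin T, t < v → σ v = σ t → s ≤ v := by
    intro v hv hvt
    by_contra hlt
    exact hfirst v hv (by omega) (by rw [← hr, ← hr, hvt])
  unfold nextRequest
  split_ifs with h
  · apply le_antisymm
    · exact iInf_le_of_le ⟨s, h⟩ (iInf_le_of_le hs
        (iInf_le_of_le (Fin.ext (by rw [hr, hr]; exact hrs)) le_rfl))
    · refine le_iInf fun v => le_iInf fun hv => le_iInf fun hvt => ?_
      exact_mod_cast Nat.succ_le_succ (hle v hv hvt)
  · refine top_unique (le_iInf fun v => le_iInf fun hv => le_iInf fun hvt => ?_)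
    have := hle v hv hvt
    omega

/-- The index of the first request after `t` of the page requested at `t`. -/
def nextIndex (N K : ℕ) (D : ℕ → Bool) (t : ℕ) : ℕ :=
  if request N K D t = K + 1 then
    if t % (K + 2) < K + 1 then t + 1
    else if IsActive N K D (t / (K + 2) + 1) then
      (t / (K + 2) + 1) * (K + 2) + (level N K (t / (K + 2) + 1) + 1)
    else (t / (K + 2) + 1) * (K + 2) + 0
  else
    (if Continues N K D (t / (K + 2)) then t / (K + 2) + N ^ (t % (K + 2))
      else nextActive N K D (t / (K + 2) + 1)) * (K + 2) + t % (K + 2)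

lemma nextIndex_congr (h : ∀ e ≤ t / (K + 2), D e = D' e) :
    nextIndex N K D t = nextIndex N K D' t := by
  rw [nextIndex, nextIndex, request_congr_of_active fun e he => h e he.le]
  have h1 : nextActive N K D (t / (K + 2) + 1) = nextActive N K D' (t / (K + 2) + 1) :=
    nextActive_congr fun e he => h e (by omega)
  simp only [Continues, IsActive, h1, h _ le_rfl]

lemma div_slot_lt {v : ℕ} (hv : d * (K + 2) + s < v) (hs : v % (K + 2) = s) : d < v / (K + 2) := by
  have h1 := Nat.div_add_mod v (K + 2)
  rw [hs, mul_comm] at h1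
  by_contra hlt
  push Not at hlt
  have := Nat.mul_le_mul_right (K + 2) hlt
  omega

lemma lt_div_slot {v : ℕ} (hv : v < d * (K + 2) + s) (hs : v % (K + 2) = s) : v / (K + 2) < d := by
  have h1 := Nat.div_add_mod v (K + 2)
  rw [hs, mul_comm] at h1
  by_contra hlt
  push Not at hlt
  have := Nat.mul_le_mul_right (K + 2) hlt
  omega

/-- For a page `s ≤ K`, only days divisible by `N ^ s` matter. If the day continues, the next such
day is the end of an opened interval, hence active. If it stops, no day before the resumption is
active, and the resumption has a larger level. -/
lemma nextIndex_spec (hN : 0 < N) (t : ℕ) : t < nextIndex N K D t ∧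
    request N K D (nextIndex N K D t) = request N K D t ∧
    ∀ v, t < v → v < nextIndex N K D t → request N K D v ≠ request N K D t := by
  obtain ⟨d, s, hs, rfl⟩ : ∃ d s, s < K + 2 ∧ t = d * (K + 2) + s :=
    ⟨t / (K + 2), t % (K + 2), Nat.mod_lt _ (by omega), by rw [mul_comm, Nat.div_add_mod]⟩
  unfold nextIndex
  rw [slot_div hs, slot_mod hs]
  split_ifs with h1 h2 h3 h4
  · refine ⟨by omega, ?_, fun v h h' => by omega⟩
    rw [h1, add_assoc, request_slot (by omega)]
    rw [if_neg]
    intro hcon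
    rw [request_slot_of_le hcon.1 (by omega)] at h1
    omega
  · have hs' : s = K + 1 := by omega
    subst hs'
    have hl : level N K (d + 1) ≤ K := level_le
    refine ⟨by rw [add_mul]; omega, ?_, fun v h h' => ?_⟩
    · rw [h1, request_slot (by omega), if_neg (by omega)]
    · obtain ⟨r, rfl⟩ : ∃ r, v = (d + 1) * (K + 2) + r :=
        ⟨v - (d + 1) * (K + 2), by rw [add_mul] at *; omega⟩
      rw [h1, request_slot_of_le h3 (by omega)]
      omega
  · have hs' : s = K + 1 := by omega
    subst hs'
    refine ⟨by rw [add_mul]; omega, ?_, fun v h h' => by rw [add_mul] at h'; omega⟩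
    rw [h1, request_slot (by omega), if_neg (by tauto)]
  -- The two remaining cases concern a page `s ≤ K` on an active day that continues or stops.
  all_goals
    have ha : IsActive N K D d ∧ s ≤ level N K d := by
      by_contra hcon
      rw [request_slot hs, if_neg hcon] at h1
      exact h1 rfl
    have hsK : s ≤ K := ha.2.trans level_le
    have hreq := request_slot_of_le ha.1 ha.2
    have hdvd := (le_level_iff hsK).1 ha.2
  · have hpos := pow_pos hN s
    have hact := isActive_of_opens hN hdvd hsK ⟨ha.1, h4⟩
    refine ⟨by rw [add_mul]; nlinarith, ?_, fun v h h' hv => ?_⟩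
    · rw [hreq, request_slot_of_le hact]
      rw [le_level_iff hsK]
      exact Nat.dvd_add hdvd dvd_rfl
    · rw [hreq, request_eq_iff hsK, le_level_iff hsK] at hv
      have h5 := div_slot_lt h hv.2.2
      have h6 := lt_div_slot h' hv.2.2
      have h7 := Nat.le_of_dvd (by omega) (Nat.dvd_sub hv.2.1 hdvd)
      omega
  · have hlt : d < nextActive N K D (d + 1) := le_nextActive hN (d + 1)
    refine ⟨by nlinarith, ?_, fun v h h' hv => ?_⟩
    · rw [hreq, request_slot_of_le (isActive_nextActive hN)]
      exact ha.2.trans (level_lt_level_nextActive ha.1 h4).le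
    · rw [hreq, request_eq_iff hsK, le_level_iff hsK] at hv
      have h5 := div_slot_lt h hv.2.2
      have h6 := lt_div_slot h' hv.2.2
      have h7 := nextActive_eq_of_le (N := N) (K := K) (D := D) (d := d + 1) h5 h6.le
      have := hv.1
      unfold IsActive at this
      omega

/-- The predictions do not reveal later bits. -/
lemma obs_congr (hN : 0 < N) (hn : K + 1 < n) {t : Fin T}
    (h : ∀ e ≤ (t : ℕ) / (K + 2), D e = D' e) :
    obs (requests N hn T D) t = obs (requests N hn T D') t := by
  have hreq := request_congr_of_active (N := N) fun e he => h e he.le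
  have key : ∀ D, nextRequest (requests N hn T D) t =
      if nextIndex N K D t < T then ((nextIndex N K D t + 1 : ℕ) : ℕ∞) else ⊤ := by
    intro D
    obtain ⟨h1, h2, h3⟩ := nextIndex_spec (K := K) (D := D) hN t
    exact nextRequest_eq_of_first (r := request N K D) (fun _ => rfl) t h1 h2 h3
  refine Prod.ext (Fin.ext hreq) ?_
  simp only [obs]
  rw [key, key, nextIndex_congr h]

lemma history_congr {σ σ' : Fin T → Fin n} (h : ∀ s : Fin T, (s : ℕ) < t → obs σ s = obs σ' s) :
    history σ t = history σ' t := by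
  unfold history
  apply List.ext_getElem
  · simp
  · intro i h1 h2
    simp only [List.length_take, List.length_ofFn] at h1
    simp only [List.getElem_take, List.getElem_ofFn]
    exact h _ (by simp; omega)

lemma run_congr {k : ℕ} (A : DetAlg n k) {σ σ' : Fin T → Fin n}
    (h : ∀ s : Fin T, (s : ℕ) < t → obs σ s = obs σ' s) : A.run σ t = A.run σ' t := by
  cases t with
  | zero => rfl
  | succ t =>
    change (if h : t < T then A.serve (history σ t) (obs σ ⟨t, h⟩) else ∅) =
      if h : t < T then A.serve (history σ' t) (obs σ' ⟨t, h⟩) else ∅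
    split_ifs with ht
    · rw [history_congr fun s hs => h s (by omega), h ⟨t, ht⟩ (by simp)]
    · rfl

/-- The cache of an online algorithm at the start of a day depends on the earlier bits only. -/
lemma run_requests_congr {k : ℕ} (hN : 0 < N) (hn : K + 1 < n) (A : DetAlg n k)
    (h : ∀ e < d, D e = D' e) (ht : t ≤ d * (K + 2)) :
    A.run (requests N hn T D) t = A.run (requests N hn T D') t :=
  run_congr A fun s hs => obs_congr hN hn fun e he => h e (by
    have : (s : ℕ) / (K + 2) < d := Nat.div_lt_of_lt_mul (by rw [mul_comm]; omega)
    omega)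

end Requests

/-! ### Costs of schedules -/

section Cost

variable {n k T t t' : ℕ} {w : Fin n → ℝ} {C : ℕ → Finset (Fin n)} {p : Fin n}

lemma evictionCost_mono (hw : ∀ p, 0 < w p) (h : t ≤ t') :
    evictionCost w t C ≤ evictionCost w t' C :=
  Finset.sum_le_sum_of_subset_of_nonneg (Finset.range_mono h)
    fun _ _ _ => Finset.sum_nonneg fun p _ => (hw p).le

lemma evictionCost_nonneg (hw : ∀ p, 0 < w p) : 0 ≤ evictionCost w t C :=
  Finset.sum_nonneg fun _ _ => Finset.sum_nonneg fun p _ => (hw p).le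

/-- A page that is cached at one time and missing later has been evicted at some step in between. -/
lemma add_evictionCost_le (hw : ∀ p, 0 < w p) (h : t ≤ t') (hp : p ∈ C t) (hp' : p ∉ C t') :
    w p + evictionCost w t C ≤ evictionCost w t' C := by
  induction t', h using Nat.le_induction with
  | base => exact absurd hp hp'
  | succ t' h ih =>
    by_cases hpt : p ∈ C t'
    · have h1 : w p ≤ ∑ q ∈ C t' \ C (t' + 1), w q :=
        Finset.single_le_sum (f := w) (fun q _ => (hw q).le) (Finset.mem_sdiff.2 ⟨hpt, hp'⟩)
      have h2 := evictionCost_mono (C := C) hw h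
      have h3 : evictionCost w (t' + 1) C = evictionCost w t' C + ∑ q ∈ C t' \ C (t' + 1), w q :=
        Finset.sum_range_succ _ _
      linarith
    · exact (ih hpt).trans (evictionCost_mono hw (Nat.le_succ t'))

lemma opt_le {σ : Fin T → Fin n} (hw : ∀ p, 0 < w p) (hC : IsSchedule k σ C) :
    opt k w σ ≤ evictionCost w T C :=
  csInf_le ⟨0, by rintro _ ⟨C, -, rfl⟩; exact evictionCost_nonneg hw⟩ ⟨C, hC, rfl⟩

lemma opt_nonneg {σ : Fin T → Fin n} (hw : ∀ p, 0 < w p) : 0 ≤ opt k w σ :=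
  Real.sInf_nonneg (by rintro _ ⟨C, -, rfl⟩; exact evictionCost_nonneg hw)

lemma sum_range_mul_eq {α : Type*} [AddCommMonoid α] (f : ℕ → α) (L m : ℕ) :
    ∑ t ∈ Finset.range (L * m), f t =
      ∑ a ∈ Finset.range L, ∑ r ∈ Finset.range m, f (a * m + r) := by
  induction L with
  | zero => simp
  | succ L ih => rw [add_mul, one_mul, Finset.sum_range_add, ih, Finset.sum_range_succ]

end Cost

/-- The weight of the page with number `j`. -/
noncomputable def pageWeight (K j : ℕ) : ℝ := if j ≤ K then 2 ^ j else 1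

lemma pageWeight_pos (K j : ℕ) : 0 < pageWeight K j := by
  unfold pageWeight; split_ifs <;> positivity

lemma pageWeight_of_le {K j : ℕ} (h : j ≤ K) : pageWeight K j = 2 ^ j := if_pos h

/-- The page weights as a function on the pages. -/
noncomputable def weight (n K : ℕ) (p : Fin n) : ℝ := pageWeight K p

lemma weight_pos {n K : ℕ} (p : Fin n) : 0 < weight n K p := pageWeight_pos _ _

/-! ### Offline schedules with one missing page -/

section Offline

variable {N K n T M d : ℕ} {D : ℕ → Bool}

/-- Only `K + 2` pages occur and the cache holds `K + 1`, so a schedule can be described by its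
single missing page `H t`. Moving the hole evicts exactly the page that becomes missing. -/
lemma opt_le_of_hole {σ : Fin T → Fin n} (hσ : ∀ t, (σ t : ℕ) ≤ K + 1) (H : ℕ → ℕ)
    (hH : ∀ t, H t ≤ K + 1) (hs : ∀ t : Fin T, (σ t : ℕ) ≠ H (t + 1)) :
    opt (K + 1) (weight n K) σ ≤
      ∑ t ∈ Finset.range T, if H (t + 1) = H t then 0 else pageWeight K (H (t + 1)) := by
  classical
  let C : ℕ → Finset (Fin n) := fun t =>
    if t = 0 then ∅ else Finset.univ.filter fun p : Fin n => (p : ℕ) ≤ K + 1 ∧ (p : ℕ) ≠ H t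
  have hC : IsSchedule (K + 1) σ C := by
    refine ⟨by simp [C], fun t => ?_, fun t => ?_⟩
    · by_cases ht : t = 0
      · simp [C, ht]
      · have h1 : (C t).card ≤ ((Finset.range (K + 2)).erase (H t)).card := by
          refine Finset.card_le_card_of_injOn (fun p => (p : ℕ)) ?_ fun _ _ _ _ h => Fin.ext h
          intro p hp
          simp only [C, if_neg ht, Finset.coe_filter, Finset.mem_univ, true_and,
            Set.mem_ofPred_eq] at hp
          simp only [Finset.coe_erase, Finset.coe_range, Set.mem_sdiff, Set.mem_Iio,
            Set.mem_singleton_iff]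
          omega
        rw [Finset.card_erase_of_mem (Finset.mem_range.2 (by have := hH t; omega)),
          Finset.card_range] at h1
        exact h1
    · simp only [C, if_neg (Nat.succ_ne_zero _), Finset.mem_filter, Finset.mem_univ, true_and]
      exact ⟨hσ t, hs t⟩
  refine (opt_le weight_pos hC).trans (Finset.sum_le_sum fun t _ => ?_)
  -- Filling the empty cache in the first step evicts nothing.
  by_cases ht : t = 0
  · simp only [C, if_pos ht, Finset.empty_sdiff, Finset.sum_empty]
    split_ifs
    · exact le_rfl
    · exact (pageWeight_pos _ _).le
  · have hsub : ∀ p ∈ C t \ C (t + 1), (p : ℕ) = H (t + 1) ∧ H (t + 1) ≠ H t := by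
      intro p hp
      simp only [C, if_neg ht, if_neg (Nat.succ_ne_zero _), Finset.mem_sdiff, Finset.mem_filter,
        Finset.mem_univ, true_and] at hp
      have : (p : ℕ) = H (t + 1) := by
        by_contra hcon
        exact hp.2 ⟨hp.1.1, hcon⟩
      exact ⟨this, fun h => hp.1.2 (by rw [this, h])⟩
    split_ifs with h
    · rw [Finset.sum_eq_zero fun p hp => absurd h (hsub p hp).2]
    · have hcard : (C t \ C (t + 1)).card ≤ 1 :=
        Finset.card_le_one.2 fun p hp q hq =>
          Fin.ext ((hsub p hp).1.trans (hsub q hq).1.symm)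
      calc ∑ p ∈ C t \ C (t + 1), weight n K p
          = ∑ p ∈ C t \ C (t + 1), pageWeight K (H (t + 1)) :=
            Finset.sum_congr rfl fun p hp => by rw [weight, (hsub p hp).1]
        _ = (C t \ C (t + 1)).card * pageWeight K (H (t + 1)) := by
            rw [Finset.sum_const, nsmul_eq_mul]
        _ ≤ 1 * pageWeight K (H (t + 1)) :=
            mul_le_mul_of_nonneg_right (by exact_mod_cast hcard) (pageWeight_pos _ _).le
        _ = _ := one_mul _

/-- The missing page is renewed on day `d` if the calendar interval of level `lam d` around `d`
starts on the active day `d`. -/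
abbrev Renews (N K : ℕ) (D : ℕ → Bool) (lam : ℕ → ℕ) (d : ℕ) : Prop :=
  IsActive N K D d ∧ lam d ≤ level N K d

/-- The page which is missing at the start of day `d`. -/
def offlineHole (N K : ℕ) (D : ℕ → Bool) (lam : ℕ → ℕ) : ℕ → ℕ
  | 0 => 0
  | d + 1 =>
    if Renews N K D lam d then (if Continues N K D d then lam d else 0)
    else offlineHole N K D lam d

/-- A bound for the cost of the offline schedule on day `d`. -/
noncomputable def renewalCost (N K : ℕ) (D : ℕ → Bool) (lam : ℕ → ℕ) (d : ℕ) : ℝ :=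
  if Renews N K D lam d then (if Continues N K D d then 2 ^ lam d + 1 else 2) else 0

variable {lam : ℕ → ℕ}

lemma offlineHole_le (hlam : ∀ d, lam d ≤ K) (d : ℕ) : offlineHole N K D lam d ≤ K := by
  induction d with
  | zero => exact Nat.zero_le _
  | succ d ih =>
    unfold offlineHole
    split_ifs
    · exact hlam d
    · exact Nat.zero_le _
    · exact ih

/-- If the next active day does not renew the hole, the hole must be the page of the surrounding
interval of level `lam`, which that day does not request. The hypothesis `hconst` says that `lam`
changes only where the new interval starts. -/
lemma offlineHole_eq (hN : 0 < N)
    (hconst : ∀ d, level N K (d + 1) < lam (d + 1) → lam d = lam (d + 1)) (d : ℕ) :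
    level N K (nextActive N K D d) < lam (nextActive N K D d) →
      lam (nextActive N K D d) ≤ K → offlineHole N K D lam d = lam (nextActive N K D d) := by
  induction d with
  | zero =>
    intro h h'
    rw [nextActive, level_zero] at h
    rw [nextActive] at h'
    omega
  | succ d ih =>
    intro h h'
    unfold offlineHole
    by_cases ha : IsActive N K D d
    · by_cases hc : Continues N K D d
      · rw [nextActive_succ_of_opens ⟨ha, hc⟩] at h h' ⊢
        have hl := hconst d h
        by_cases hr : lam d ≤ level N K d
        · rw [if_pos ⟨ha, hr⟩, if_pos hc, hl]
        · rw [if_neg fun h => hr h.2, ← hl]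
          rw [ha] at ih
          exact ih (by omega) (by omega)
      · set q := nextActive N K D (d + 1) with hq
        have hdq : d < q := le_nextActive hN (d + 1)
        have hlev := level_lt_level_nextActive ha hc
        rw [← hq] at hlev
        -- Walk backwards from `q`: the levels in between are at most that of `d`, hence below `lam
        -- q`, so `lam` cannot change.
        have key : ∀ m ≤ q - d, lam (q - m) = lam q := by
          intro m
          induction m with
          | zero => intro _; rfl
          | succ m ihm =>
            intro hm
            have h1 := ihm (by omega)
            have h2 : q - m = q - (m + 1) + 1 := by omega
            rw [h2] at h1
            rw [← h1]
            refine hconst _ ?_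
            rw [h1, ← h2]
            rcases Nat.eq_zero_or_pos m with rfl | hmpos
            · exact h
            · have := level_le_of_between ha hc (e := q - m) (by omega) (by omega)
              omega
        have hl : lam d = lam q := by
          have := key (q - d) (by omega)
          rwa [show q - (q - d) = d by omega] at this
        -- A renewal at `d` would give `lam q ≤ level d < level q`, against the assumption on `q`.
        -- So after a renewal on a stopping day the next active day renews again, and the cheap hole
        -- `0` is safe.
        rw [if_neg fun h => by have := h.2; omega, ← hl]
        rw [ha] at ih
        exact ih (by omega) (by omega)
    · rw [nextActive_succ_of_not ha] at h h' ⊢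
      rw [if_neg fun h => ha h.1]
      exact ih h h'

/-- The page which is missing while the request at index `t - 1` is served. -/
def offlineHoleAt (N K : ℕ) (D : ℕ → Bool) (lam : ℕ → ℕ) : ℕ → ℕ
  | 0 => 0
  | t + 1 =>
    if Renews N K D lam (t / (K + 2)) ∧ t % (K + 2) ≤ level N K (t / (K + 2)) then K + 1
    else offlineHole N K D lam (t / (K + 2) + 1)

lemma offlineHoleAt_slot {s : ℕ} (hs : s < K + 2) :
    offlineHoleAt N K D lam (d * (K + 2) + s + 1) =
      if Renews N K D lam d ∧ s ≤ level N K d then K + 1 else offlineHole N K D lam (d + 1) := by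
  rw [offlineHoleAt, slot_div hs, slot_mod hs]

lemma offlineHoleAt_start : offlineHoleAt N K D lam (d * (K + 2)) = offlineHole N K D lam d := by
  cases d with
  | zero => simp [offlineHoleAt, offlineHole]
  | succ d =>
    have h := offlineHoleAt_slot (N := N) (K := K) (D := D) (lam := lam) (d := d) (s := K + 1)
      (by omega)
    have hl : level N K d ≤ K := level_le
    rw [if_neg (by omega)] at h
    rw [← h]
    congr 1
    ring

/-- On a renewal day page `K + 1` is dropped while the pages up to the level are served; then it
returns and the new hole is made. On all other days the hole stays put. -/
lemma opt_le_sum_renewalCost (hN : 0 < N) (hn : K + 1 < n) (hlam : ∀ d, lam d ≤ K)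
    (hconst : ∀ d, level N K (d + 1) < lam (d + 1) → lam d = lam (d + 1)) :
    opt (K + 1) (weight n K) (requests N hn (M * (K + 2)) D) ≤
      ∑ d ∈ Finset.range M, renewalCost N K D lam d := by
  have hle := offlineHole_le (N := N) (D := D) hlam
  have hdec : ∀ t, ∃ d s, s < K + 2 ∧ t = d * (K + 2) + s := fun t =>
    ⟨t / (K + 2), t % (K + 2), Nat.mod_lt _ (by omega), by rw [mul_comm, Nat.div_add_mod]⟩
  refine (opt_le_of_hole (fun _ => request_le) (offlineHoleAt N K D lam) ?_ ?_).trans ?_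
  · intro t
    cases t with
    | zero => exact Nat.zero_le _
    | succ t =>
      rw [offlineHoleAt]
      split_ifs
      · exact le_rfl
      · exact (hle _).trans (Nat.le_succ K)
  · rintro ⟨t, ht⟩
    change request N K D t ≠ offlineHoleAt N K D lam (t + 1)
    obtain ⟨d, s, hs, rfl⟩ := hdec t
    have h1 := hle (d + 1)
    have hl : level N K d ≤ K := level_le
    rw [offlineHoleAt_slot hs, request_slot hs]
    split_ifs with h2 h3 h3
    · omega
    · have hr : ¬ Renews N K D lam d := fun h => h3 ⟨h, h2.2⟩
      have hlt : level N K d < lam d := by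
        by_contra hcon
        exact hr ⟨h2.1, by omega⟩
      have hh := offlineHole_eq (D := D) hN hconst d
      rw [h2.1] at hh
      rw [offlineHole, if_neg hr, hh hlt (hlam d)]
      omega
    · exact absurd ⟨h3.1.1, h3.2⟩ h2
    · omega
  · rw [sum_range_mul_eq]
    refine Finset.sum_le_sum fun d _ => ?_
    have hl : level N K d ≤ K := level_le
    by_cases hr : Renews N K D lam d
    · have hpt : ∀ s ∈ Finset.range (K + 2),
          (if offlineHoleAt N K D lam (d * (K + 2) + s + 1) =
              offlineHoleAt N K D lam (d * (K + 2) + s)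
            then 0 else pageWeight K (offlineHoleAt N K D lam (d * (K + 2) + s + 1))) ≤
          (if s = 0 then 1 else 0) + (if s = level N K d + 1 then
            pageWeight K (offlineHole N K D lam (d + 1)) else 0) := by
        intro s hs
        have hs := Finset.mem_range.1 hs
        have hpos := pageWeight_pos K (offlineHole N K D lam (d + 1))
        rcases Nat.eq_zero_or_pos s with rfl | hs0
        · have hw : pageWeight K (K + 1) = 1 := if_neg (by omega)
          have hv : offlineHoleAt N K D lam (d * (K + 2) + 0 + 1) = K + 1 := by
            rw [offlineHoleAt_slot hs, if_pos ⟨hr, Nat.zero_le _⟩]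
          rw [hv, hw]
          split_ifs <;> first | omega | linarith
        · obtain ⟨s, rfl⟩ := Nat.exists_eq_add_of_le' hs0
          have h0 : (if s + 1 = 0 then (1 : ℝ) else 0) = 0 := if_neg (by omega)
          rw [h0, zero_add, offlineHoleAt_slot hs, ← add_assoc, offlineHoleAt_slot (by omega)]
          rcases lt_trichotomy s (level N K d) with h | h | h
          · rw [if_pos (show Renews N K D lam d ∧ s + 1 ≤ level N K d from ⟨hr, h⟩),
              if_pos (show Renews N K D lam d ∧ s ≤ level N K d from ⟨hr, h.le⟩), if_pos rfl]
            split_ifs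
            · exact hpos.le
            · exact le_rfl
          · rw [if_neg (show ¬ (_ ∧ s + 1 ≤ _) by omega), if_pos (show s + 1 = _ by omega)]
            split_ifs
            · exact hpos.le
            · exact le_rfl
            · exact hpos.le
            · exact le_rfl
          · rw [if_neg (show ¬ (_ ∧ s + 1 ≤ _) by omega), if_neg (show ¬ (_ ∧ s ≤ _) by omega),
              if_pos rfl]
            split_ifs
            · exact hpos.le
            · exact le_rfl
      refine (Finset.sum_le_sum hpt).trans ?_
      rw [Finset.sum_add_distrib, Finset.sum_ite_eq', Finset.sum_ite_eq', if_pos (by simp),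
        if_pos (by simp; omega), offlineHole, if_pos hr, renewalCost, if_pos hr]
      split_ifs
      · rw [pageWeight_of_le (hlam d), add_comm]
      · rw [pageWeight_of_le (Nat.zero_le K)]
        norm_num
    · rw [renewalCost, if_neg hr]
      refine (Finset.sum_eq_zero fun s hs => ?_).le
      have hs := Finset.mem_range.1 hs
      have hne : ∀ s, ¬ (Renews N K D lam d ∧ s ≤ level N K d) := fun s h => hr h.1
      rcases Nat.eq_zero_or_pos s with rfl | hs0
      · rw [offlineHoleAt_slot hs, add_zero, offlineHoleAt_start, if_neg (hne 0), offlineHole,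
          if_neg hr, if_pos rfl]
      · obtain ⟨s, rfl⟩ := Nat.exists_eq_add_of_le' hs0
        rw [offlineHoleAt_slot hs, ← add_assoc, offlineHoleAt_slot (by omega), if_neg (hne _),
          if_neg (hne _), if_pos rfl]

end Offline

/-! ### Online algorithms, day by day -/

section Online

variable {N K n k M d e j t : ℕ} {D D' : ℕ → Bool}

/-- The numbers of the pages in the cache at the start of day `d`. -/
noncomputable def cacheAt (N : ℕ) (hn : K + 1 < n) (M : ℕ) (A : DetAlg n (K + 1)) (D : ℕ → Bool)
    (d : ℕ) : Finset ℕ :=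
  (A.run (requests N hn (M * (K + 2)) D) (d * (K + 2))).map Fin.valEmbedding

/-- The cost before day `d`. -/
noncomputable def costBefore (N : ℕ) (hn : K + 1 < n) (M : ℕ) (A : DetAlg n (K + 1))
    (D : ℕ → Bool) (d : ℕ) : ℝ :=
  evictionCost (weight n K) (d * (K + 2)) (A.run (requests N hn (M * (K + 2)) D))

variable {hn : K + 1 < n} {A : DetAlg n (K + 1)}

lemma cacheAt_congr (hN : 0 < N) (h : ∀ e < d, D e = D' e) :
    cacheAt N hn M A D d = cacheAt N hn M A D' d := by
  rw [cacheAt, cacheAt, run_requests_congr hN hn A h le_rfl]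

lemma costBefore_zero : costBefore N hn M A D 0 = 0 := by
  simp [costBefore, evictionCost]

lemma costBefore_last : costBefore N hn M A D M =
    A.cost (weight n K) (requests N hn (M * (K + 2)) D) := rfl

lemma costBefore_mono (h : d ≤ e) : costBefore N hn M A D d ≤ costBefore N hn M A D e :=
  evictionCost_mono weight_pos (Nat.mul_le_mul_right _ h)

lemma DetAlg.card_run_le {T : ℕ} {A : DetAlg n k} {σ : Fin T → Fin n} (t : ℕ) :
    (A.run σ t).card ≤ k := by
  cases t with
  | zero => simp [DetAlg.run]
  | succ t =>
    change (if h : t < T then A.serve (history σ t) (obs σ ⟨t, h⟩) else ∅).card ≤ k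
    split_ifs
    · exact A.card_le _ _
    · simp

lemma DetAlg.mem_run {T : ℕ} {A : DetAlg n k} {σ : Fin T → Fin n} (t : Fin T) :
    σ t ∈ A.run σ (t + 1) := by
  change σ t ∈ if h : (t : ℕ) < T then A.serve (history σ t) (obs σ ⟨t, h⟩) else ∅
  rw [dif_pos t.2]
  exact A.mem_serve (history σ t) (obs σ t)

/-- The day has just ended with a request to page `K + 1`, so the cache has room for only `K` of the
pages `0, …, K`. -/
lemma exists_not_mem_cacheAt (hd : d < M) : ∃ j ≤ K, j ∉ cacheAt N hn M A D (d + 1) := by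
  by_contra! hcon
  have hlt : d * (K + 2) + (K + 1) < M * (K + 2) := by
    have := Nat.mul_le_mul_right (K + 2) (Nat.succ_le_of_lt hd)
    rw [Nat.succ_mul] at this
    omega
  have hmem : K + 1 ∈ cacheAt N hn M A D (d + 1) := by
    have := DetAlg.mem_run (A := A) (σ := requests N hn (M * (K + 2)) D) ⟨_, hlt⟩
    refine Finset.mem_map.2 ⟨requests N hn (M * (K + 2)) D ⟨_, hlt⟩, ?_, request_last⟩
    rw [show (d + 1) * (K + 2) = d * (K + 2) + (K + 1) + 1 by ring]
    exact this
  have hsub : Finset.range (K + 2) ⊆ cacheAt N hn M A D (d + 1) := by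
    intro j hj
    have := Finset.mem_range.1 hj
    rcases Nat.lt_or_ge K j with h | h
    · rwa [show j = K + 1 by omega]
    · exact hcon j h
  have h1 := Finset.card_le_card hsub
  rw [Finset.card_range, cacheAt, Finset.card_map] at h1
  have := DetAlg.card_run_le (A := A) (σ := requests N hn (M * (K + 2)) D) ((d + 1) * (K + 2))
  omega

/-- A page which was in the cache at some time of day `d` has been paid for if it is missing
at the end of the day. -/
lemma pow_add_costBefore_le (hd : d < M) (hj : j ≤ K)
    (h : j ∈ cacheAt N hn M A D d ∨ IsActive N K D d ∧ j ≤ level N K d)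
    (hj' : j ∉ cacheAt N hn M A D (d + 1)) :
    2 ^ j + costBefore N hn M A D d ≤ costBefore N hn M A D (d + 1) := by
  have hjn : j < n := by omega
  have hend : (⟨j, hjn⟩ : Fin n) ∉
      A.run (requests N hn (M * (K + 2)) D) ((d + 1) * (K + 2)) :=
    fun hcon => hj' (Finset.mem_map.2 ⟨_, hcon, rfl⟩)
  have hwt : weight n K ⟨j, hjn⟩ = 2 ^ j := pageWeight_of_le hj
  rw [← hwt]
  rcases h with h | h
  · obtain ⟨p, hp, rfl⟩ := Finset.mem_map.1 h
    exact add_evictionCost_le weight_pos (Nat.mul_le_mul_right _ (Nat.le_succ d)) hp hend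
  · have hlt : d * (K + 2) + j < M * (K + 2) := by
      have := Nat.mul_le_mul_right (K + 2) (Nat.succ_le_of_lt hd)
      rw [Nat.succ_mul] at this
      omega
    have hmem := DetAlg.mem_run (A := A) (σ := requests N hn (M * (K + 2)) D) ⟨_, hlt⟩
    have heq : requests N hn (M * (K + 2)) D ⟨_, hlt⟩ = ⟨j, hjn⟩ :=
      Fin.ext (request_slot_of_le h.1 h.2)
    rw [heq] at hmem
    have h1 := add_evictionCost_le (w := weight n K) weight_pos
      (show d * (K + 2) + j + 1 ≤ (d + 1) * (K + 2) by rw [add_mul]; omega) hmem hend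
    have h2 : costBefore N hn M A D d ≤ _ :=
      evictionCost_mono (C := A.run (requests N hn (M * (K + 2)) D)) weight_pos
        (show d * (K + 2) ≤ d * (K + 2) + j + 1 by omega)
    exact (add_le_add_right h2 _).trans h1

end Online

/-! ### The deterministic lower bound -/

section Deterministic

variable {N K n M d e i j x R : ℕ} {D : ℕ → Bool} {hn : K + 1 < n} {A : DetAlg n (K + 1)}

/-- The cost on day `d`. -/
noncomputable def dayCost (N : ℕ) (hn : K + 1 < n) (M : ℕ) (A : DetAlg n (K + 1)) (D : ℕ → Bool)
    (d : ℕ) : ℝ :=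
  costBefore N hn M A D (d + 1) - costBefore N hn M A D d

lemma dayCost_nonneg : 0 ≤ dayCost N hn M A D d :=
  sub_nonneg.2 (costBefore_mono (Nat.le_succ d))

lemma sum_dayCost : ∑ d ∈ Finset.range M, dayCost N hn M A D d =
    A.cost (weight n K) (requests N hn (M * (K + 2)) D) := by
  unfold dayCost
  rw [Finset.sum_range_sub, costBefore_zero, sub_zero, costBefore_last]

lemma pow_le_dayCost (hd : d < M) (hj : j ≤ K)
    (h : j ∈ cacheAt N hn M A D d ∨ IsActive N K D d ∧ j ≤ level N K d)
    (hj' : j ∉ cacheAt N hn M A D (d + 1)) : 2 ^ j ≤ dayCost N hn M A D d :=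
  le_sub_iff_add_le.2 (pow_add_costBefore_le hd hj h hj')

/-- The bits which the adversary chooses on the first days. -/
noncomputable def adversaryPrefix (N : ℕ) (hn : K + 1 < n) (M : ℕ) (A : DetAlg n (K + 1)) :
    ℕ → ℕ → Bool
  | 0 => fun _ => true
  | d + 1 => Function.update (adversaryPrefix N hn M A d) d
      (decide (∀ j ≤ K, level N K d < j → j ∈ cacheAt N hn M A (adversaryPrefix N hn M A d) d))

/-- The adversary continues as long as no page of higher level than the day is missing. -/
noncomputable def adversary (N : ℕ) (hn : K + 1 < n) (M : ℕ) (A : DetAlg n (K + 1)) (d : ℕ) :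
    Bool :=
  adversaryPrefix N hn M A (d + 1) d

lemma adversaryPrefix_eq (h : e < d) : adversaryPrefix N hn M A d e = adversary N hn M A e := by
  induction d, h using Nat.le_induction with
  | base => rfl
  | succ d h ih =>
    rw [adversaryPrefix, Function.update_of_ne (by omega), ih]

/-- The recursive definition unfolds to a self-consistent rule because the cache at the start of day
`d` depends on the earlier bits only. -/
lemma adversary_eq_true_iff (hN : 0 < N) : adversary N hn M A d = true ↔
    ∀ j ≤ K, level N K d < j → j ∈ cacheAt N hn M A (adversary N hn M A) d := by
  rw [adversary, adversaryPrefix, Function.update_self, decide_eq_true_iff,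
    cacheAt_congr hN fun e he => adversaryPrefix_eq he]

lemma mem_cacheAt_of_opens (hN : 0 < N) (ho : Opens N K (adversary N hn M A) d) (hj : j ≤ K)
    (hl : level N K d < j) : j ∈ cacheAt N hn M A (adversary N hn M A) d := by
  rcases ho.2 with h | h
  · exact (adversary_eq_true_iff hN).1 h j hj hl
  · omega

/-- On an opening day each page up to `K` is in the cache at some time: the low ones are requested,
the high ones are present by the adversary's rule. One of them is missing at the end. -/
lemma one_le_dayCost (hN : 0 < N) (hd : d < M) (ho : Opens N K (adversary N hn M A) d) :
    1 ≤ dayCost N hn M A (adversary N hn M A) d := by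
  obtain ⟨j, hj, hj'⟩ :=
    exists_not_mem_cacheAt (N := N) (hn := hn) (A := A) (D := adversary N hn M A) hd
  refine (one_le_pow₀ one_le_two).trans (pow_le_dayCost hd hj ?_ hj')
  rcases Nat.lt_or_ge (level N K d) j with h | h
  · exact Or.inl (mem_cacheAt_of_opens hN ho hj h)
  · exact Or.inr ⟨ho.1, h⟩

/-- In an opened interval of level `i + 1` the algorithm evicts a page of level at least `i + 1`,
or all children of the interval are opened. -/
lemma opens_children (hN : 0 < N) (hi : i < K) (hx : N ^ (i + 1) ∣ x) (hM : x + N ^ (i + 1) ≤ M)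
    (ho : Opens N K (adversary N hn M A) x)
    (hcost : ∀ r < N ^ (i + 1), dayCost N hn M A (adversary N hn M A) (x + r) < 2 ^ (i + 1)) :
    ∀ b < N, Opens N K (adversary N hn M A) (x + b * N ^ i) := by
  -- As no day in the interval costs `2 ^ (i + 1)`, pages above level `i` are never missing at the
  -- end of a day.
  have hmem : ∀ r < N ^ (i + 1), ∀ j ≤ K, i < j →
      j ∈ cacheAt N hn M A (adversary N hn M A) (x + r + 1) := by
    intro r
    induction r with
    | zero =>
      intro hr j hj hij
      by_contra hcon
      have h := hcost 0 hr
      have h2 : (2 : ℝ) ^ (i + 1) ≤ 2 ^ j := pow_le_pow_right₀ one_le_two hij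
      have := pow_le_dayCost (d := x) (by omega) hj ?_ hcon
      · rw [add_zero] at h
        linarith
      · rcases Nat.lt_or_ge (level N K x) j with h | h
        · exact Or.inl (mem_cacheAt_of_opens hN ho hj h)
        · exact Or.inr ⟨ho.1, h⟩
    | succ r ih =>
      intro hr j hj hij
      by_contra hcon
      have h := hcost (r + 1) hr
      have h2 : (2 : ℝ) ^ (i + 1) ≤ 2 ^ j := pow_le_pow_right₀ one_le_two hij
      have := pow_le_dayCost (d := x + (r + 1)) (by omega) hj
        (Or.inl (ih (by omega) j hj hij)) hcon
      linarith
  intro b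
  induction b with
  | zero => intro _; simpa using ho
  | succ b ih =>
    intro hb
    have hdvd : N ^ i ∣ x + b * N ^ i :=
      Nat.dvd_add ((pow_dvd_pow N (Nat.le_succ i)).trans hx) (dvd_mul_left _ _)
    have hact := isActive_of_opens hN hdvd hi.le (ih (by omega))
    rw [show x + b * N ^ i + N ^ i = x + (b + 1) * N ^ i by ring] at hact
    refine ⟨hact, Or.inl ((adversary_eq_true_iff hN).2 fun j hj hij => ?_)⟩
    rw [level_child hN hi hx (by omega) hb] at hij
    have hlt : (b + 1) * N ^ i < N ^ (i + 1) := by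
      rw [pow_succ, mul_comm (N ^ i)]
      exact Nat.mul_lt_mul_of_pos_right hb (pow_pos hN i)
    have hpos : 0 < (b + 1) * N ^ i := Nat.mul_pos (by omega) (pow_pos hN i)
    have := hmem ((b + 1) * N ^ i - 1) (by omega) j hj hij
    rwa [show x + ((b + 1) * N ^ i - 1) + 1 = x + (b + 1) * N ^ i by omega] at this

/-- Day `d` opens an interval of level `i`. -/
abbrev OpensLevel (N K : ℕ) (D : ℕ → Bool) (i d : ℕ) : Prop := N ^ i ∣ d ∧ Opens N K D d

/-- The number of opened intervals of level `i` in the first `M` days. -/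
noncomputable def numOpened (N K M : ℕ) (D : ℕ → Bool) (i : ℕ) : ℝ :=
  ∑ d ∈ Finset.range M, if OpensLevel N K D i d then 1 else 0

/-- The number of days with cost at least `2 ^ i`. -/
noncomputable def numExpensive (N : ℕ) (hn : K + 1 < n) (M : ℕ) (A : DetAlg n (K + 1))
    (D : ℕ → Bool) (i : ℕ) : ℝ :=
  ∑ d ∈ Finset.range M, if 2 ^ i ≤ dayCost N hn M A D d then 1 else 0

/-- The dichotomy of `opens_children`, summed over all intervals of level `i + 1`: an opened one
contributes an expensive day or `N` opened children. -/
lemma mul_numOpened_le (hN : 0 < N) (hi : i < K) (hM : N ^ (i + 1) ∣ M) :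
    N * numOpened N K M (adversary N hn M A) (i + 1) ≤
      N * numExpensive N hn M A (adversary N hn M A) (i + 1) +
        numOpened N K M (adversary N hn M A) i := by
  obtain ⟨L, hL⟩ := hM
  rw [mul_comm] at hL
  have hsum : ∀ f : ℕ → ℝ, ∑ d ∈ Finset.range M, f d =
      ∑ a ∈ Finset.range L, ∑ r ∈ Finset.range (N ^ (i + 1)), f (a * N ^ (i + 1) + r) :=
    fun f => by rw [← sum_range_mul_eq f L, ← hL]
  unfold numOpened numExpensive
  rw [hsum, hsum, hsum, Finset.mul_sum, Finset.mul_sum, ← Finset.sum_add_distrib]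
  refine Finset.sum_le_sum fun a ha => ?_
  have ha := Finset.mem_range.1 ha
  set x := a * N ^ (i + 1) with hxdef
  have hx : N ^ (i + 1) ∣ x := dvd_mul_left _ _
  have hxM : x + N ^ (i + 1) ≤ M := by
    rw [hL, hxdef, ← Nat.succ_mul]
    exact Nat.mul_le_mul_right _ ha
  have hpos := pow_pos hN (i + 1)
  have hsingle : ∑ r ∈ Finset.range (N ^ (i + 1)),
      (if OpensLevel N K (adversary N hn M A) (i + 1) (x + r) then (1 : ℝ) else 0) =
      if Opens N K (adversary N hn M A) x then 1 else 0 := by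
    rw [Finset.sum_eq_single_of_mem 0 (Finset.mem_range.2 hpos)]
    · simp only [OpensLevel, add_zero, hx, true_and]
    · intro r hr hr0
      refine if_neg fun h => ?_
      have := Nat.le_of_dvd (by omega) ((Nat.dvd_add_right hx).1 h.1)
      have := Finset.mem_range.1 hr
      omega
  rw [hsingle]
  have hnonneg : ∀ P : ℕ → Prop, ∀ [DecidablePred P], ∀ m : ℕ,
      0 ≤ ∑ r ∈ Finset.range m, if P r then (1 : ℝ) else 0 := fun P _ m =>
    Finset.sum_nonneg fun r _ => by split_ifs <;> norm_num
  split_ifs with ho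
  · by_cases hcost : ∀ r < N ^ (i + 1), dayCost N hn M A (adversary N hn M A) (x + r) < 2 ^ (i + 1)
    · have hch := opens_children hN hi hx hxM ho hcost
      have h1 : (N : ℝ) ≤ ∑ r ∈ Finset.range (N ^ (i + 1)),
          if OpensLevel N K (adversary N hn M A) i (x + r) then (1 : ℝ) else 0 := by
        rw [pow_succ, mul_comm, sum_range_mul_eq]
        calc (N : ℝ) = ∑ b ∈ Finset.range N, 1 := by simp
          _ ≤ _ := Finset.sum_le_sum fun b hb => ?_
        refine le_trans ?_ (Finset.single_le_sum
          (f := fun r => if OpensLevel N K (adversary N hn M A) i (x + (b * N ^ i + r)) then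
            (1 : ℝ) else 0) (fun r _ => by positivity)
          (Finset.mem_range.2 (pow_pos hN i)))
        rw [add_zero, if_pos]
        exact ⟨Nat.dvd_add ((pow_dvd_pow N (Nat.le_succ i)).trans hx) (dvd_mul_left _ _),
          hch b (Finset.mem_range.1 hb)⟩
      have h2 := hnonneg (fun r => 2 ^ (i + 1) ≤ dayCost N hn M A (adversary N hn M A) (x + r))
        (N ^ (i + 1))
      have h3 : (0 : ℝ) ≤ N := Nat.cast_nonneg N
      nlinarith
    · push Not at hcost
      obtain ⟨r, hr, hcost⟩ := hcost
      have h1 : (1 : ℝ) ≤ ∑ r ∈ Finset.range (N ^ (i + 1)),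
          if 2 ^ (i + 1) ≤ dayCost N hn M A (adversary N hn M A) (x + r) then (1 : ℝ) else 0 := by
        refine le_trans ?_ (Finset.single_le_sum
          (f := fun r => if 2 ^ (i + 1) ≤ dayCost N hn M A (adversary N hn M A) (x + r) then
            (1 : ℝ) else 0) (fun r _ => by positivity) (Finset.mem_range.2 hr))
        rw [if_pos hcost]
      have h2 := hnonneg (fun r => OpensLevel N K (adversary N hn M A) i (x + r)) (N ^ (i + 1))
      have h3 : (0 : ℝ) ≤ N := Nat.cast_nonneg N
      nlinarith
  · have h1 := hnonneg (fun r => OpensLevel N K (adversary N hn M A) i (x + r)) (N ^ (i + 1))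
    have h2 := hnonneg (fun r => 2 ^ (i + 1) ≤ dayCost N hn M A (adversary N hn M A) (x + r))
      (N ^ (i + 1))
    have h3 : (0 : ℝ) ≤ N := Nat.cast_nonneg N
    rw [mul_zero]
    positivity

lemma numOpened_zero_le (hN : 0 < N) : numOpened N K M (adversary N hn M A) 0 ≤
    numExpensive N hn M A (adversary N hn M A) 0 := by
  refine Finset.sum_le_sum fun d hd => ?_
  split_ifs with h1 h2 h2
  · exact le_rfl
  · exact absurd ((pow_zero _).trans_le (one_le_dayCost hN (Finset.mem_range.1 hd) h1.2)) h2
  · exact zero_le_one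
  · exact le_rfl

lemma sum_two_pow (m : ℕ) : ∑ i ∈ Finset.range m, (2 : ℝ) ^ i = 2 ^ m - 1 := by
  induction m with
  | zero => simp
  | succ m ih => rw [Finset.sum_range_succ, ih]; ring

/-- The powers of two up to `a` form a geometric sum dominated by its largest term. -/
lemma sum_two_pow_of_le {a : ℝ} (ha : 0 ≤ a) (m : ℕ) :
    ∑ i ∈ Finset.range m, (2 : ℝ) ^ i * (if 2 ^ i ≤ a then 1 else 0) ≤ 2 * a := by
  induction m with
  | zero => simpa using ha
  | succ m ih =>
    by_cases h : (2 : ℝ) ^ m ≤ a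
    · calc _ ≤ ∑ i ∈ Finset.range (m + 1), (2 : ℝ) ^ i := Finset.sum_le_sum fun i _ => by
            have : (0 : ℝ) ≤ 2 ^ i := by positivity
            split_ifs <;> linarith
        _ ≤ 2 * a := by rw [sum_two_pow, pow_succ]; linarith
    · rw [Finset.sum_range_succ, if_neg h, mul_zero, add_zero]
      exact ih

/-- The total weight of the pages of the opened intervals. -/
lemma sum_numOpened_le (hM : 4 ^ K ∣ M) :
    ∑ i ∈ Finset.range (K + 1), 2 ^ i * numOpened 4 K M (adversary 4 hn M A) i ≤
      4 * A.cost (weight n K) (requests 4 hn (M * (K + 2)) (adversary 4 hn M A)) := by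
  set Op := numOpened 4 K M (adversary 4 hn M A) with hOp
  set Ex := numExpensive 4 hn M A (adversary 4 hn M A) with hEx
  have h1 : ∑ i ∈ Finset.range (K + 1), 2 ^ i * Ex i ≤
      2 * A.cost (weight n K) (requests 4 hn (M * (K + 2)) (adversary 4 hn M A)) := by
    rw [← sum_dayCost, Finset.mul_sum, hEx]
    unfold numExpensive
    simp only [Finset.mul_sum]
    rw [Finset.sum_comm]
    refine Finset.sum_le_sum fun d _ => ?_
    exact sum_two_pow_of_le dayCost_nonneg _
  -- Here `N = 4` matters: weights double per level while the number of children is `4`, so the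
  -- recursion contracts by `2 / 4`.
  have h2 : ∀ i ∈ Finset.range K,
      2 ^ (i + 1) * Op (i + 1) ≤ 2 ^ (i + 1) * Ex (i + 1) + (2 ^ i * Op i) / 2 := by
    intro i hi
    have hi := Finset.mem_range.1 hi
    have h := mul_numOpened_le (N := 4) (hn := hn) (M := M) (A := A) (by norm_num) hi
      ((pow_dvd_pow 4 hi).trans hM)
    rw [← hOp, ← hEx] at h
    push_cast at h
    have hp : (0 : ℝ) < 2 ^ i := by positivity
    rw [pow_succ]
    nlinarith
  have h3 := Finset.sum_le_sum h2
  rw [Finset.sum_add_distrib, ← Finset.sum_div] at h3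
  have h4 : Op 0 ≤ Ex 0 := numOpened_zero_le (by norm_num)
  have h5 : ∑ i ∈ Finset.range (K + 1), 2 ^ i * Op i =
      ∑ i ∈ Finset.range K, 2 ^ (i + 1) * Op (i + 1) + Op 0 := by
    rw [Finset.sum_range_succ']; simp
  have h6 : ∑ i ∈ Finset.range (K + 1), 2 ^ i * Ex i =
      ∑ i ∈ Finset.range K, 2 ^ (i + 1) * Ex (i + 1) + Ex 0 := by
    rw [Finset.sum_range_succ']; simp
  have h7 : ∑ i ∈ Finset.range (K + 1), 2 ^ i * Op i =
      ∑ i ∈ Finset.range K, 2 ^ i * Op i + 2 ^ K * Op K := Finset.sum_range_succ _ _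
  have h8 : 0 ≤ 2 ^ K * Op K := mul_nonneg (by positivity)
    (Finset.sum_nonneg fun d _ => by split_ifs <;> norm_num)
  linarith

/-! ### Offline cost against the adversary. -/

lemma succ_le_two_pow (m : ℕ) : (m : ℝ) + 1 ≤ 2 ^ m := by
  exact_mod_cast Nat.succ_le_of_lt Nat.lt_two_pow_self

/-- The schedules which use one level only. -/
lemma sum_renewalCost_const_le (d : ℕ) :
    ∑ i ∈ Finset.range (K + 1), renewalCost N K D (fun _ => i) d ≤
      4 * ∑ i ∈ Finset.range (K + 1), 2 ^ i * (if OpensLevel N K D i d then 1 else 0) +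
        2 * (2 ^ level N K (nextActive N K D (d + 1)) - 2 ^ level N K (nextActive N K D d)) := by
  set l := level N K d with hl
  have hlK : l ≤ K := level_le
  have hfilter : ∀ f : ℕ → ℝ, ∑ i ∈ Finset.range (K + 1), (if i ≤ l then f i else 0) =
      ∑ i ∈ Finset.range (l + 1), f i := by
    intro f
    rw [← Finset.sum_filter]
    congr 1
    ext i
    simp only [Finset.mem_filter, Finset.mem_range]
    omega
  have hlin := succ_le_two_pow l
  have hone : (1 : ℝ) ≤ 2 ^ l := one_le_pow₀ one_le_two
  have hopen : ∀ i ∈ Finset.range (K + 1), (2 : ℝ) ^ i * (if OpensLevel N K D i d then 1 else 0) =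
      if Opens N K D d then (if i ≤ l then 2 ^ i else 0) else 0 := by
    intro i hi
    have := le_level_iff (N := N) (d := d) (Nat.lt_succ_iff.1 (Finset.mem_range.1 hi))
    rw [← hl] at this
    simp only [OpensLevel, ← this]
    split_ifs <;> first | tauto | simp
  rw [Finset.sum_congr rfl hopen]
  by_cases ha : IsActive N K D d
  · have hq : level N K (nextActive N K D d) = l := by rw [show nextActive N K D d = d from ha]
    rw [hq]
    have hren : ∀ i, Renews N K D (fun _ => i) d ↔ i ≤ l := fun i => and_iff_right ha
    simp only [renewalCost, hren]
    rw [hfilter]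
    by_cases hc : Continues N K D d
    · simp only [eq_true hc, eq_true (show Opens N K D d from ⟨ha, hc⟩), if_true]
      rw [hfilter, Finset.sum_add_distrib, sum_two_pow, pow_succ]
      have : (1 : ℝ) ≤ 2 ^ level N K (nextActive N K D (d + 1)) := one_le_pow₀ one_le_two
      simp only [Finset.sum_const, Finset.card_range, nsmul_eq_mul]
      push_cast
      linarith
    · simp only [eq_false hc, eq_false (show ¬ Opens N K D d from fun h => hc h.2), if_false]
      have h1 := level_lt_level_nextActive ha hc
      rw [← hl] at h1
      have h2 : (2 : ℝ) ^ (l + 1) ≤ 2 ^ level N K (nextActive N K D (d + 1)) :=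
        pow_le_pow_right₀ one_le_two h1
      rw [pow_succ] at h2
      simp only [Finset.sum_const, Finset.card_range, nsmul_eq_mul]
      push_cast
      linarith
  · rw [nextActive_succ_of_not ha]
    simp [renewalCost, Renews, Opens, ha]

/-- The optimum is at most the average over the `K + 1` one-level schedules. Their cost on stopping
days is absorbed by the growth of `2 ^ level` at the next active day. -/
lemma mul_opt_le_sum_numOpened (hN : 0 < N) :
    (K + 1) * opt (K + 1) (weight n K) (requests N hn (M * (K + 2)) D) ≤
      4 * ∑ i ∈ Finset.range (K + 1), 2 ^ i * numOpened N K M D i := by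
  have h1 : ∀ i ∈ Finset.range (K + 1),
      opt (K + 1) (weight n K) (requests N hn (M * (K + 2)) D) ≤
        ∑ d ∈ Finset.range M, renewalCost N K D (fun _ => i) d := fun i hi =>
    opt_le_sum_renewalCost hN hn (fun _ => Nat.lt_succ_iff.1 (Finset.mem_range.1 hi))
      fun _ _ => rfl
  have h2 := Finset.sum_le_sum h1
  rw [Finset.sum_const, Finset.card_range, nsmul_eq_mul, Finset.sum_comm] at h2
  have h3 := Finset.sum_le_sum fun d (_ : d ∈ Finset.range M) =>
    sum_renewalCost_const_le (N := N) (K := K) (D := D) d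
  rw [Finset.sum_add_distrib, ← Finset.mul_sum, ← Finset.mul_sum,
    Finset.sum_range_sub fun d => (2 : ℝ) ^ level N K (nextActive N K D d)] at h3
  -- Day `0` has the maximal level `K`, so the telescoping potential contributes nothing positive.
  have h4 : (2 : ℝ) ^ level N K (nextActive N K D M) ≤ 2 ^ level N K (nextActive N K D 0) := by
    rw [nextActive, level_zero]
    exact pow_le_pow_right₀ one_le_two level_le
  simp only [numOpened, Finset.mul_sum] at h3 ⊢
  rw [Finset.sum_comm]
  push_cast at h2
  linarith

lemma exists_requests_of_detAlg (hn : K + 1 < n) (A : DetAlg n (K + 1)) (R : ℕ) :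
    ∃ (T : ℕ) (σ : Fin T → Fin n), R ≤ A.cost (weight n K) σ ∧
      (K + 1) * opt (K + 1) (weight n K) σ ≤ 16 * A.cost (weight n K) σ := by
  set M := R * 4 ^ K with hM
  refine ⟨M * (K + 2), requests 4 hn (M * (K + 2)) (adversary 4 hn M A), ?_, ?_⟩
  · rw [← sum_dayCost]
    calc (R : ℝ) = ∑ a ∈ Finset.range R, 1 := by simp
      _ ≤ ∑ a ∈ Finset.range R, ∑ r ∈ Finset.range (4 ^ K),
          dayCost 4 hn M A (adversary 4 hn M A) (a * 4 ^ K + r) :=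
        Finset.sum_le_sum fun a ha => ?_
      _ = _ := by
        rw [← sum_range_mul_eq fun d => dayCost 4 hn M A (adversary 4 hn M A) d]
    refine le_trans ?_ (Finset.single_le_sum (fun r _ => dayCost_nonneg)
      (Finset.mem_range.2 (pow_pos (by norm_num : 0 < 4) K)))
    refine one_le_dayCost (by norm_num) ?_ (opens_mul_pow (by norm_num) a)
    exact Nat.mul_lt_mul_of_pos_right (Finset.mem_range.1 ha) (by positivity)
  · have h1 := mul_opt_le_sum_numOpened (N := 4) (hn := hn) (M := M) (D := adversary 4 hn M A)
      (by norm_num)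
    have h2 := sum_numOpened_le (hn := hn) (A := A) (M := M) (dvd_mul_left _ _)
    linarith

/-- A lower bound for `r` from instances with `α * R ≤ r * O + b`, where `O ≤ β * R`
and `R` is arbitrarily large. -/
lemma le_of_unbounded_instances {α β r b : ℝ} (hα : 0 < α) (hβ : 0 < β)
    (h : ∀ R : ℕ, ∃ S O : ℝ, (R : ℝ) ≤ S ∧ 0 ≤ O ∧ O ≤ β * S ∧ α * S ≤ r * O + b) : α / β ≤ r := by
  by_contra! hlt
  rw [lt_div_iff₀ hβ] at hlt
  -- The minimum covers both signs of `r`: the bound on `O` is used if `r ≥ 0`, and `O ≥ 0`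
  -- otherwise.
  have key : ∀ R : ℕ, min α (α - r * β) * R ≤ b := by
    intro R
    obtain ⟨S, O, hS, hO, hOS, hle⟩ := h R
    have hS0 : 0 ≤ S := (Nat.cast_nonneg R).trans hS
    have hpos : 0 < min α (α - r * β) := lt_min hα (by linarith)
    refine (mul_le_mul_of_nonneg_left hS hpos.le).trans ?_
    rcases le_total 0 r with hr | hr
    · have h1 := mul_le_mul_of_nonneg_left hOS hr
      have h2 := mul_le_mul_of_nonneg_right (min_le_right α (α - r * β)) hS0
      nlinarith
    · have h1 := mul_nonpos_of_nonpos_of_nonneg hr hO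
      have h2 := mul_le_mul_of_nonneg_right (min_le_left α (α - r * β)) hS0
      linarith
  have hpos : 0 < min α (α - r * β) := lt_min hα (by linarith)
  obtain ⟨R, hR⟩ := exists_nat_gt (b / min α (α - r * β))
  rw [div_lt_iff₀ hpos] at hR
  have := key R
  linarith

lemma DetAlg.IsCompetitive.le (hn : K + 1 < n) {A : DetAlg n (K + 1)} {r : ℝ}
    (hA : A.IsCompetitive (weight n K) r) : 1 / 16 * ((K : ℝ) + 1) ≤ r := by
  obtain ⟨b, hb⟩ := hA
  have hK : (0 : ℝ) < K + 1 := by positivity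
  have := le_of_unbounded_instances (α := 1) (β := 16 / (K + 1)) (r := r) (b := b) one_pos
    (by positivity) fun R => by
      obtain ⟨T, σ, h1, h2⟩ := exists_requests_of_detAlg hn A R
      refine ⟨A.cost (weight n K) σ, opt (K + 1) (weight n K) σ, h1, opt_nonneg weight_pos, ?_, ?_⟩
      · rw [div_mul_eq_mul_div, le_div_iff₀ hK]
        linarith
      · rw [one_mul]
        exact hb T σ
  rwa [one_div_div, ← mul_one_div, mul_comm] at this

end Deterministic

/-! ### Uniformly random bits -/

section Mean

variable {M d : ℕ} {F G : (ℕ → Bool) → ℝ} {S : Finset ℕ}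

/-- Extend finitely many bits. -/
def extendBits (f : Fin M → Bool) (d : ℕ) : Bool := if h : d < M then f ⟨d, h⟩ else true

/-- The mean of `F` when the first `M` bits are uniformly random. -/
noncomputable def mean (M : ℕ) (F : (ℕ → Bool) → ℝ) : ℝ :=
  (∑ f : Fin M → Bool, F (extendBits f)) / 2 ^ M

/-- Flip bit `d`. -/
def flipBit (D : ℕ → Bool) (d : ℕ) : ℕ → Bool := Function.update D d (!D d)

lemma mean_mono (h : ∀ D, F D ≤ G D) : mean M F ≤ mean M G :=
  div_le_div_of_nonneg_right (Finset.sum_le_sum fun _ _ => h _) (by positivity)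

lemma mean_const (c : ℝ) : mean M (fun _ => c) = c := by
  simp [mean]

lemma mean_add : mean M (fun D => F D + G D) = mean M F + mean M G := by
  simp only [mean, Finset.sum_add_distrib, add_div]

lemma mean_sub : mean M (fun D => F D - G D) = mean M F - mean M G := by
  simp only [mean, Finset.sum_sub_distrib, sub_div]

lemma mean_const_mul (c : ℝ) : mean M (fun D => c * F D) = c * mean M F := by
  simp only [mean, ← Finset.mul_sum, mul_div_assoc]

lemma mean_sum {ι : Type*} (s : Finset ι) (F : ι → (ℕ → Bool) → ℝ) :
    mean M (fun D => ∑ i ∈ s, F i D) = ∑ i ∈ s, mean M (F i) := by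
  simp only [mean]
  rw [Finset.sum_comm, Finset.sum_div]

lemma mean_flipBit (hd : d < M) : mean M (fun D => F (flipBit D d)) = mean M F := by
  unfold mean
  congr 1
  have hinv : Function.Involutive fun f : Fin M → Bool =>
      Function.update f ⟨d, hd⟩ (!f ⟨d, hd⟩) := by
    intro f
    simp
  rw [← Equiv.sum_comp hinv.toPerm]
  refine Finset.sum_congr rfl fun f _ => congrArg F ?_
  funext e
  simp only [Function.Involutive.coe_toPerm, flipBit, extendBits, hd, dif_pos]
  by_cases he : e = d
  · subst he
    simp [hd]
  · rw [Function.update_of_ne he]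
    by_cases heM : e < M
    · rw [extendBits, dif_pos heM, dif_pos heM, Function.update_of_ne (by simpa using he)]
    · rw [extendBits, dif_neg heM, dif_neg heM]

/-- Flipping a bit preserves the uniform distribution, so it suffices that the two outcomes of one
bit compensate each other. -/
lemma mean_nonneg_of_add_flipBit (hd : d < M) (h : ∀ D, 0 ≤ F D + F (flipBit D d)) :
    0 ≤ mean M F := by
  have h1 : mean M (fun _ => 0) ≤ mean M (fun D => F D + F (flipBit D d)) := mean_mono h
  rw [mean_const, mean_add, mean_flipBit hd] at h1
  linarith

lemma mean_ite (hd : d < M) (hF : ∀ D, F (flipBit D d) = F D) :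
    mean M (fun D => if D d = true then F D else 0) = mean M F / 2 := by
  have h1 := mean_flipBit (F := fun D => if D d = true then F D else 0) hd
  have h2 : mean M F = mean M (fun D => if D d = true then F D else 0) +
      mean M (fun D => if flipBit D d d = true then F (flipBit D d) else 0) := by
    rw [← mean_add]
    congr 1
    funext D
    rw [hF]
    cases h : D d <;> simp [flipBit, h]
  linarith

lemma mean_ite_forall (hS : ∀ d ∈ S, d < M) (hF : ∀ D, ∀ d ∈ S, F (flipBit D d) = F D) :
    mean M (fun D => if ∀ d ∈ S, D d = true then F D else 0) = mean M F * (1 / 2) ^ S.card := by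
  induction S using Finset.induction_on with
  | empty => simp
  | insert d S hdS ih =>
    have ih := ih (fun e he => hS e (Finset.mem_insert_of_mem he))
      fun D e he => hF D e (Finset.mem_insert_of_mem he)
    have hd := hS d (Finset.mem_insert_self d S)
    have h := mean_ite (F := fun D => if ∀ e ∈ S, D e = true then F D else 0) hd (fun D => by
      have h1 : (∀ e ∈ S, flipBit D d e = true) ↔ ∀ e ∈ S, D e = true :=
        forall₂_congr fun e he => by
          rw [flipBit, Function.update_of_ne (ne_of_mem_of_not_mem he hdS)]
      simp only [h1, hF D d (Finset.mem_insert_self d S)])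
    rw [ih] at h
    rw [Finset.card_insert_of_notMem hdS, pow_succ]
    have h2 : ∀ D : ℕ → Bool, (if ∀ e ∈ insert d S, D e = true then F D else 0) =
        if D d = true then (if ∀ e ∈ S, D e = true then F D else 0) else 0 := by
      intro D
      simp only [Finset.forall_mem_insert]
      split_ifs <;> first | rfl | tauto
    simp only [h2, h]
    ring

end Mean

/-! ### The online cost against random bits -/

section RandomOnline

variable {N K n M d j : ℕ} {D D' : ℕ → Bool} {hn : K + 1 < n} {A : DetAlg n (K + 1)}

/-- The expected future savings by the missing page at the start of day `d`. -/
noncomputable def savings (N : ℕ) (hn : K + 1 < n) (M : ℕ) (A : DetAlg n (K + 1)) (D : ℕ → Bool)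
    (d : ℕ) : ℝ :=
  (Finset.range (K + 1)).sup' ⟨0, by simp⟩ fun j =>
    if j ∈ cacheAt N hn M A D d then 0 else max 0 (2 ^ j - 2 ^ level N K (nextActive N K D d))

lemma le_savings (hj : j ≤ K) (hj' : j ∉ cacheAt N hn M A D d) :
    2 ^ j - 2 ^ level N K (nextActive N K D d) ≤ savings N hn M A D d := by
  refine le_trans ?_ (Finset.le_sup' _ (Finset.mem_range.2 (Nat.lt_succ_iff.2 hj)))
  rw [if_neg hj']
  exact le_max_right _ _

lemma savings_nonneg : 0 ≤ savings N hn M A D d := by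
  refine le_trans ?_ (Finset.le_sup' _ (Finset.mem_range.2 (Nat.succ_pos K)))
  split_ifs
  · exact le_rfl
  · exact le_max_left _ _

lemma savings_le {c : ℝ} (hc : 0 ≤ c) (h : ∀ j ≤ K, j ∉ cacheAt N hn M A D d →
    2 ^ j - 2 ^ level N K (nextActive N K D d) ≤ c) : savings N hn M A D d ≤ c := by
  refine Finset.sup'_le _ _ fun j hj => ?_
  split_ifs with hj'
  · exact hc
  · exact max_le hc (h j (Nat.lt_succ_iff.1 (Finset.mem_range.1 hj)) hj')

lemma savings_zero : savings N hn M A D 0 = 0 := by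
  refine le_antisymm (savings_le le_rfl fun j hj _ => ?_) savings_nonneg
  rw [nextActive, level_zero, sub_nonpos]
  exact pow_le_pow_right₀ one_le_two hj

lemma savings_congr (hN : 0 < N) (h : ∀ e < d, D e = D' e) :
    savings N hn M A D d = savings N hn M A D' d := by
  rw [savings, savings, nextActive_congr h, cacheAt_congr hN h]

/-- The indicator of an opening day. -/
noncomputable def openInd (N K : ℕ) (D : ℕ → Bool) (d : ℕ) : ℝ := if Opens N K D d then 1 else 0

/-- The amount by which the cost on day `d` exceeds the change of the potential. -/
noncomputable def surplus (N : ℕ) (hn : K + 1 < n) (M : ℕ) (A : DetAlg n (K + 1)) (D : ℕ → Bool)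
    (d : ℕ) : ℝ :=
  dayCost N hn M A D d + savings N hn M A D d - savings N hn M A D (d + 1) - openInd N K D d

/-- The next active day is unchanged, so the potential can grow only through a newly missing page,
whose eviction pays for it. -/
lemma surplus_of_not_isActive (hd : d < M) (ha : ¬ IsActive N K D d) :
    0 ≤ surplus N hn M A D d := by
  have hc : 0 ≤ dayCost N hn M A D d := dayCost_nonneg
  have hs : 0 ≤ savings N hn M A D d := savings_nonneg
  have h : savings N hn M A D (d + 1) ≤ dayCost N hn M A D d + savings N hn M A D d := by
    refine savings_le (by linarith) fun j hj hj' => ?_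
    rw [nextActive_succ_of_not ha]
    have hp : (0 : ℝ) < 2 ^ level N K (nextActive N K D d) := by positivity
    by_cases hjd : j ∈ cacheAt N hn M A D d
    · have := pow_le_dayCost hd hj (Or.inl hjd) hj'
      linarith
    · have := le_savings hj hjd
      linarith
  rw [surplus, openInd, if_neg fun h => ha h.1]
  linarith

/-- If no page above the level is missing, every page missing at the end was evicted today, and the
saved `2 ^ level ≥ 1` of the next active day covers the opening. If one is missing, the potential
may rise as the reference level drops, but by at most `2 ^ level N K d - 1`. -/
lemma surplus_of_opens (hd : d < M) (ho : Opens N K D d) : 0 ≤ surplus N hn M A D d ∨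
    level N K d < K ∧ 2 ^ level N K d ≤ savings N hn M A D d ∧
      -2 ^ level N K d ≤ surplus N hn M A D d := by
  have hc : 0 ≤ dayCost N hn M A D d := dayCost_nonneg
  have hs : 0 ≤ savings N hn M A D d := savings_nonneg
  rw [surplus, openInd, if_pos ho]
  have hone : ∀ i : ℕ, (1 : ℝ) ≤ 2 ^ i := fun i => one_le_pow₀ one_le_two
  have hact : nextActive N K D d = d := ho.1
  by_cases hkeep : ∃ j ≤ K, level N K d < j ∧ j ∉ cacheAt N hn M A D d
  · right
    obtain ⟨j, hj, hlj, hjd⟩ := hkeep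
    have h1 := le_savings hj hjd
    have h2 : (2 : ℝ) ^ (level N K d + 1) ≤ 2 ^ j := pow_le_pow_right₀ one_le_two hlj
    rw [hact] at h1
    rw [pow_succ] at h2
    have h3 : savings N hn M A D (d + 1) ≤
        dayCost N hn M A D d + savings N hn M A D d + 2 ^ level N K d - 1 := by
      refine savings_le (by linarith [hone (level N K d)]) fun i hi hi' => ?_
      have := hone (level N K (nextActive N K D (d + 1)))
      by_cases hid : i ∈ cacheAt N hn M A D d ∨ IsActive N K D d ∧ i ≤ level N K d
      · have := pow_le_dayCost hd hi hid hi'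
        linarith [hone (level N K d)]
      · push Not at hid
        have := le_savings hi hid.1
        rw [hact] at this
        linarith
    exact ⟨by omega, by linarith, by linarith⟩
  · left
    push Not at hkeep
    have hall : ∀ i ≤ K, i ∈ cacheAt N hn M A D d ∨ IsActive N K D d ∧ i ≤ level N K d := by
      intro i hi
      rcases Nat.lt_or_ge (level N K d) i with h | h
      · exact Or.inl (hkeep i hi h)
      · exact Or.inr ⟨ho.1, h⟩
    obtain ⟨j, hj, hj'⟩ := exists_not_mem_cacheAt (N := N) (hn := hn) (A := A) (D := D) hd
    have h1 := pow_le_dayCost hd hj (hall j hj) hj'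
    have h3 : savings N hn M A D (d + 1) ≤ dayCost N hn M A D d - 1 := by
      refine savings_le (by linarith [hone j]) fun i hi hi' => ?_
      have := hone (level N K (nextActive N K D (d + 1)))
      have := pow_le_dayCost hd hi (hall i hi) hi'
      linarith
    linarith

/-- Activity resumes at a strictly larger level, so the term subtracted in the potential at least
doubles. If a page above the level is missing, this releases the `2 ^ level` that the opposite bit
may lose. -/
lemma surplus_of_stop (hd : d < M) (ha : IsActive N K D d) (hc : ¬ Continues N K D d) :
    0 ≤ surplus N hn M A D d ∧
      (2 ^ level N K d ≤ savings N hn M A D d → 2 ^ level N K d ≤ surplus N hn M A D d) := by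
  have hc0 : 0 ≤ dayCost N hn M A D d := dayCost_nonneg
  have hs : 0 ≤ savings N hn M A D d := savings_nonneg
  rw [surplus, openInd, if_neg fun h => hc h.2]
  have hact : nextActive N K D d = d := ha
  have hp : (0 : ℝ) < 2 ^ level N K d := by positivity
  have hl : (2 : ℝ) ^ (level N K d + 1) ≤ 2 ^ level N K (nextActive N K D (d + 1)) :=
    pow_le_pow_right₀ one_le_two (level_lt_level_nextActive ha hc)
  rw [pow_succ] at hl
  have key : ∀ j ≤ K, j ∉ cacheAt N hn M A D (d + 1) →
      2 ^ j ≤ dayCost N hn M A D d ∨ 2 ^ j - 2 ^ level N K d ≤ savings N hn M A D d := by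
    intro j hj hj'
    by_cases hjd : j ∈ cacheAt N hn M A D d
    · exact Or.inl (pow_le_dayCost hd hj (Or.inl hjd) hj')
    · have := le_savings hj hjd
      rw [hact] at this
      exact Or.inr this
  constructor
  · have : savings N hn M A D (d + 1) ≤ dayCost N hn M A D d + savings N hn M A D d := by
      refine savings_le (by linarith) fun j hj hj' => ?_
      rcases key j hj hj' with h | h <;> linarith
    linarith
  · intro h
    have : savings N hn M A D (d + 1) ≤
        dayCost N hn M A D d + savings N hn M A D d - 2 ^ level N K d := by
      refine savings_le (by linarith) fun j hj hj' => ?_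
      rcases key j hj hj' with h | h <;> linarith
    linarith

/-- Bit `d` affects neither the cache nor the potential at the start of day `d`, so both outcomes
fall into the same case, and a loss `2 ^ level` when opening meets a gain `2 ^ level` when stopping.
-/
lemma mean_surplus_nonneg (hN : 0 < N) (hd : d < M) : 0 ≤ mean M (surplus N hn M A · d) := by
  refine mean_nonneg_of_add_flipBit hd fun D => ?_
  have hagree : ∀ D : ℕ → Bool, ∀ e < d, D e = flipBit D d e := fun D e he => by
    rw [flipBit, Function.update_of_ne he.ne]
  have key : ∀ D D' : ℕ → Bool, (∀ e < d, D e = D' e) → D d = true → D' d = false →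
      0 ≤ surplus N hn M A D d + surplus N hn M A D' d := by
    intro D D' h hD hD'
    have hact : IsActive N K D d ↔ IsActive N K D' d := by
      rw [IsActive, IsActive, nextActive_congr h]
    by_cases ha : IsActive N K D d
    · have ha' := hact.1 ha
      rcases surplus_of_opens (hn := hn) (A := A) hd ⟨ha, Or.inl hD⟩ with h1 | ⟨h1, h2, h3⟩
      · by_cases hc : Continues N K D' d
        · have hK : level N K d = K := by
            rcases hc with hc | hc
            · rw [hD'] at hc; cases hc
            · exact hc
          rcases surplus_of_opens (hn := hn) (A := A) hd ⟨ha', hc⟩ with h4 | h4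
          · linarith
          · omega
        · have := (surplus_of_stop (hn := hn) (A := A) hd ha' hc).1
          linarith
      · have hc : ¬ Continues N K D' d := by
          rintro (hc | hc)
          · rw [hD'] at hc; cases hc
          · omega
        rw [savings_congr hN h] at h2
        have := (surplus_of_stop (hn := hn) (A := A) hd ha' hc).2 h2
        linarith
    · have h1 := surplus_of_not_isActive (hn := hn) (A := A) hd ha
      have h2 := surplus_of_not_isActive (hn := hn) (A := A) hd fun h => ha (hact.2 h)
      linarith
  cases hD : D d
  · rw [add_comm]
    exact key _ _ (fun e he => (hagree D e he).symm) (by simp [flipBit, hD]) hD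
  · exact key _ _ (hagree D) hD (by simp [flipBit, hD])

/-- Against random bits, every deterministic algorithm pays at least `1` per opening day. -/
lemma mean_openInd_le_mean_cost (hN : 0 < N) :
    ∑ d ∈ Finset.range M, mean M (openInd N K · d) ≤
      mean M (fun D => A.cost (weight n K) (requests N hn (M * (K + 2)) D)) := by
  have h1 : 0 ≤ ∑ d ∈ Finset.range M, mean M (surplus N hn M A · d) :=
    Finset.sum_nonneg fun d hd => mean_surplus_nonneg hN (Finset.mem_range.1 hd)
  rw [← mean_sum] at h1
  rw [← mean_sum, ← sub_nonneg, ← mean_sub]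
  refine h1.trans (mean_mono fun D => ?_)
  have h2 : ∀ d, surplus N hn M A D d = dayCost N hn M A D d -
      (savings N hn M A D (d + 1) - savings N hn M A D d) - openInd N K D d := fun d => by
    rw [surplus]; ring
  simp only [h2]
  rw [Finset.sum_sub_distrib, Finset.sum_sub_distrib, sum_dayCost, Finset.sum_range_sub,
    savings_zero]
  have := savings_nonneg (N := N) (hn := hn) (M := M) (A := A) (D := D) (d := M)
  linarith

end RandomOnline

/-! ### Recursive estimates over the tree of calendar intervals -/

section Tree

variable {N K n M R a b d e i j x : ℕ} {D D' : ℕ → Bool}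

/-- The days on which the children `1, …, b` of the interval of level `i + 1` at `x` start. -/
def childStarts (N i x b : ℕ) : Finset ℕ := (Finset.Icc 1 b).image fun c => x + c * N ^ i

lemma card_childStarts (hN : 0 < N) : (childStarts N i x b).card = b := by
  rw [childStarts, Finset.card_image_of_injective, Nat.card_Icc, Nat.add_sub_cancel]
  intro c c' h
  exact Nat.eq_of_mul_eq_mul_right (pow_pos hN i) (Nat.add_left_cancel h)

lemma mem_childStarts : e ∈ childStarts N i x b ↔ ∃ c, 1 ≤ c ∧ c ≤ b ∧ x + c * N ^ i = e := by
  simp [childStarts, and_assoc]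

/-- The bits continue at the starts of the first children. -/
abbrev ChildrenOpen (N i x b : ℕ) (D : ℕ → Bool) : Prop := ∀ e ∈ childStarts N i x b, D e = true

lemma child_end_le (hb : b < N) : b * N ^ i + N ^ i ≤ N ^ (i + 1) := by
  rw [pow_succ, mul_comm (N ^ i), ← Nat.succ_mul]
  exact Nat.mul_le_mul_right _ hb

lemma childStarts_mem_Ioo (hN : 0 < N) (hb : b < N) (he : e ∈ childStarts N i x b) :
    x < e ∧ e < x + N ^ (i + 1) := by
  obtain ⟨c, hc, hcb, rfl⟩ := mem_childStarts.1 he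
  have h1 := child_end_le (i := i) (show c < N by omega)
  have h2 := pow_pos hN i
  have h3 := Nat.mul_pos hc h2
  omega

lemma childrenOpen_congr (hN : 0 < N) (hb : b < N)
    (h : ∀ e, x < e → e < x + N ^ (i + 1) → D e = D' e) :
    ChildrenOpen N i x b D ↔ ChildrenOpen N i x b D' :=
  forall₂_congr fun e he => by
    have := childStarts_mem_Ioo hN hb he
    rw [h e this.1 this.2]

lemma opens_child (hN : 0 < N) (hi : i < K) (hx : N ^ (i + 1) ∣ x) (ho : Opens N K D x)
    (hb : b < N) (hD : ChildrenOpen N i x b D) : Opens N K D (x + b * N ^ i) := by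
  induction b with
  | zero => simpa using ho
  | succ b ih =>
    have ih := ih (by omega) fun e he => by
      obtain ⟨c, hc, hcb, rfl⟩ := mem_childStarts.1 he
      exact hD _ (mem_childStarts.2 ⟨c, hc, by omega, rfl⟩)
    have hdvd : N ^ i ∣ x + b * N ^ i :=
      Nat.dvd_add ((pow_dvd_pow N (Nat.le_succ i)).trans hx) (dvd_mul_left _ _)
    have hact := isActive_of_opens hN hdvd hi.le ih
    rw [show x + b * N ^ i + N ^ i = x + (b + 1) * N ^ i by ring] at hact
    exact ⟨hact, Or.inl (hD _ (mem_childStarts.2 ⟨b + 1, by omega, le_rfl, rfl⟩))⟩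

/-- The number of opening days in an opened interval of level `i` which starts at `x`. -/
def treeOpenings (N : ℕ) : ℕ → (ℕ → Bool) → ℕ → ℝ
  | 0, _, _ => 1
  | i + 1, D, x => ∑ b ∈ Finset.range N,
      if ChildrenOpen N i x b D then treeOpenings N i D (x + b * N ^ i) else 0

/-- The offline cost in an opened interval of level `i` which starts at `x` and is not contained
in a larger interval all of whose children are opened. -/
def treeCost (N : ℕ) : ℕ → (ℕ → Bool) → ℕ → ℝ
  | 0, _, _ => 2
  | i + 1, D, x =>
      if ChildrenOpen N i x (N - 1) D then 2 ^ (i + 1) + 1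
      else 2 + ∑ b ∈ Finset.range N,
        if ChildrenOpen N i x b D then treeCost N i D (x + b * N ^ i) else 0

lemma treeOpenings_congr (hN : 0 < N) : ∀ (i x : ℕ),
    (∀ e, x < e → e < x + N ^ i → D e = D' e) → treeOpenings N i D x = treeOpenings N i D' x
  | 0, _, _ => rfl
  | i + 1, x, h => by
    unfold treeOpenings
    refine Finset.sum_congr rfl fun b hb => ?_
    have hb := Finset.mem_range.1 hb
    have hend := child_end_le (i := i) hb
    simp only [childrenOpen_congr hN hb h]
    rw [treeOpenings_congr hN i _ fun e he he' => h e (by omega) (by omega)]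

lemma treeCost_congr (hN : 0 < N) : ∀ (i x : ℕ),
    (∀ e, x < e → e < x + N ^ i → D e = D' e) → treeCost N i D x = treeCost N i D' x
  | 0, _, _ => rfl
  | i + 1, x, h => by
    unfold treeCost
    simp only [childrenOpen_congr hN (show N - 1 < N by omega) h]
    congr 2
    refine Finset.sum_congr rfl fun b hb => ?_
    have hb := Finset.mem_range.1 hb
    have hend := child_end_le (i := i) hb
    simp only [childrenOpen_congr hN hb h]
    rw [treeCost_congr hN i _ fun e he he' => h e (by omega) (by omega)]

lemma childStarts_not_mem_child (he : e ∈ childStarts N i x a) :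
    ¬ (x + b * N ^ i < e ∧ e < x + b * N ^ i + N ^ i) := by
  obtain ⟨c, -, -, rfl⟩ := mem_childStarts.1 he
  rintro ⟨h1, h2⟩
  have h3 : b < c := Nat.lt_of_mul_lt_mul_right (show b * N ^ i < c * N ^ i by omega)
  have h4 : c < b + 1 := Nat.lt_of_mul_lt_mul_right
    (show c * N ^ i < (b + 1) * N ^ i by rw [Nat.succ_mul]; omega)
  omega

/-- Bits at the starts of children lie outside the interior of child `b`, hence are independent of
`F`. -/
lemma mean_ite_childrenOpen (hN : 0 < N) (ha : a < N) (hx : x + N ^ (i + 1) ≤ M)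
    {F : (ℕ → Bool) → ℝ} (hF : ∀ D D' : ℕ → Bool, (∀ e, x + b * N ^ i < e →
      e < x + b * N ^ i + N ^ i → D e = D' e) → F D = F D') :
    mean M (fun D => if ChildrenOpen N i x a D then F D else 0) = mean M F * (1 / 2) ^ a := by
  have h := mean_ite_forall (M := M) (F := F) (S := childStarts N i x a) (fun e he => by
    have := childStarts_mem_Ioo hN ha he
    omega) fun D e he => hF _ _ fun e' h1 h2 => by
      rw [flipBit, Function.update_of_ne]
      rintro rfl
      exact childStarts_not_mem_child he ⟨h1, h2⟩
  rw [card_childStarts hN] at h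
  exact h

lemma sum_half_pow (m : ℕ) :
    ∑ b ∈ Finset.range (m + 1), (1 / 2 : ℝ) ^ b = 2 - (1 / 2) ^ m := by
  induction m with
  | zero => norm_num
  | succ m ih => rw [Finset.sum_range_succ, ih]; ring

/-- Child `b` is opened with probability `2 ^ (-b)`, independently of its interior; the geometric
sum is the growth factor per level. -/
lemma mean_treeOpenings (hN : 0 < N) : ∀ i x, x + N ^ i ≤ M →
    mean M (treeOpenings N i · x) = (2 - (1 / 2) ^ (N - 1)) ^ i
  | 0, x, _ => by simp only [treeOpenings, mean_const, pow_zero]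
  | i + 1, x, hx => by
    simp only [treeOpenings]
    rw [mean_sum, pow_succ (2 - (1 / 2 : ℝ) ^ (N - 1)), ← sum_half_pow,
      Nat.sub_add_cancel (Nat.succ_le_of_lt hN), Finset.mul_sum]
    refine Finset.sum_congr rfl fun b hb => ?_
    have hb := Finset.mem_range.1 hb
    have hend := child_end_le (i := i) hb
    rw [mean_ite_childrenOpen (b := b) hN hb hx fun D D' h => treeOpenings_congr hN i _ h,
      mean_treeOpenings hN i _ (by omega), ← Nat.sub_add_cancel (Nat.succ_le_of_lt hN),
      sum_half_pow]
    simp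

lemma childrenOpen_mono (hab : a ≤ b) (h : ChildrenOpen N i x b D) : ChildrenOpen N i x a D := by
  intro e he
  obtain ⟨c, hc, hca, rfl⟩ := mem_childStarts.1 he
  exact h _ (mem_childStarts.2 ⟨c, hc, hca.trans hab, rfl⟩)

/-- Writing "child `b` is opened but not all children are" as a difference of two indicators lets
each be averaged by independence. -/
lemma treeCost_succ_le : treeCost N (i + 1) D x ≤
    2 + (2 ^ (i + 1) + 1) * (if ChildrenOpen N i x (N - 1) D then 1 else 0) +
      ∑ b ∈ Finset.range N,
        ((if ChildrenOpen N i x b D then treeCost N i D (x + b * N ^ i) else 0) -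
          if ChildrenOpen N i x (N - 1) D then treeCost N i D (x + b * N ^ i) else 0) := by
  rw [treeCost]
  by_cases h : ChildrenOpen N i x (N - 1) D
  · rw [if_pos h, if_pos h, Finset.sum_eq_zero]
    · linarith
    · intro b hb
      have hb := Finset.mem_range.1 hb
      rw [if_pos h, if_pos (childrenOpen_mono (by omega) h), sub_self]
  · simp only [if_neg h, sub_zero, mul_zero, add_zero]
    exact le_rfl

/-- The expected offline cost in an interval of level `i`, for `p = 2 ^ (1 - N)`. -/
lemma mean_treeCost_le {p ν : ℝ} (hN : 0 < N) (hp : p = (1 / 2) ^ (N - 1))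
    (hν : ν = 2 - (N + 1) * p) (hν' : 3 / 2 ≤ ν) : ∀ i x, x + N ^ i ≤ M →
    mean M (treeCost N i · x) ≤ 2 / (N + 1) * 2 ^ i + 8 * ν ^ i - 6
  | 0, x, _ => by
    simp only [treeCost, mean_const, pow_zero]
    have : (0 : ℝ) ≤ 2 / (N + 1) := by positivity
    linarith
  | i + 1, x, hx => by
    set B : ℝ := 2 / (N + 1) * 2 ^ i + 8 * ν ^ i - 6 with hB
    have hp1 : p ≤ 1 := by rw [hp]; exact pow_le_one₀ (by norm_num) (by norm_num)
    -- The expected number of opened children to recurse into.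
    have hsum : ∑ b ∈ Finset.range N, ((1 / 2 : ℝ) ^ b - p) = ν := by
      rw [Finset.sum_sub_distrib]
      nth_rewrite 1 [← Nat.sub_add_cancel (Nat.succ_le_of_lt hN)]
      rw [sum_half_pow, Finset.sum_const, Finset.card_range, nsmul_eq_mul, hν, ← hp]
      ring
    have h1 : mean M (treeCost N (i + 1) · x) ≤ 2 + (2 ^ (i + 1) + 1) * p + ν * B := by
      refine (mean_mono fun D => treeCost_succ_le).trans ?_
      rw [mean_add, mean_add, mean_const, mean_const_mul, mean_sum, ← hsum, Finset.sum_mul]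
      have h2 := mean_ite_childrenOpen (N := N) (i := i) (x := x) (a := N - 1) (b := 0) (M := M)
        (F := fun _ => 1) hN (by omega) hx fun _ _ _ => rfl
      rw [mean_const, one_mul, ← hp] at h2
      rw [h2]
      refine add_le_add_right (Finset.sum_le_sum fun b hb => ?_) _
      have hb := Finset.mem_range.1 hb
      have hend := child_end_le (i := i) hb
      rw [mean_sub,
        mean_ite_childrenOpen (b := b) hN hb hx fun D D' h => treeCost_congr hN i _ h,
        mean_ite_childrenOpen (b := b) hN (show N - 1 < N by omega) hx
          fun D D' h => treeCost_congr hN i _ h, ← mul_sub, mul_comm, ← hp]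
      refine mul_le_mul_of_nonneg_left
        (mean_treeCost_le hN hp hν hν' i _ (by omega)) (sub_nonneg.2 ?_)
      rw [hp]
      exact pow_le_pow_of_le_one (by norm_num) (by norm_num) (by omega)
    refine h1.trans ?_
    have hN1 : (N + 1 : ℝ) ≠ 0 := by positivity
    -- The coefficient `2 / (N + 1)` is chosen so that the inhomogeneous term `2 ^ (i + 1) * p`
    -- cancels exactly. The constant `-6` survives because `2 + p - 6 * ν ≤ -6` when `ν ≥ 3 / 2`.
    have h3 : ν * (2 / (N + 1)) = 2 * (2 / (N + 1)) - 2 * p := by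
      rw [hν]; field_simp
    have h4 : ν * B = ν * (2 / (N + 1)) * 2 ^ i + 8 * ν ^ (i + 1) - 6 * ν := by
      rw [hB, pow_succ]; ring
    rw [h4, h3, pow_succ]
    nlinarith

lemma treeOpenings_le (hN : 0 < N) : ∀ i x, i ≤ K → N ^ i ∣ x → Opens N K D x →
    treeOpenings N i D x ≤ ∑ r ∈ Finset.range (N ^ i), openInd N K D (x + r)
  | 0, x, _, _, ho => by
    rw [treeOpenings, pow_zero, Finset.sum_range_one, add_zero, openInd, if_pos ho]
  | i + 1, x, hi, hx, ho => by
    rw [treeOpenings, pow_succ, mul_comm, sum_range_mul_eq]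
    refine Finset.sum_le_sum fun b hb => ?_
    split_ifs with h
    · simp only [← add_assoc]
      exact treeOpenings_le hN i _ (by omega)
        (Nat.dvd_add ((pow_dvd_pow N (Nat.le_succ i)).trans hx) (dvd_mul_left _ _))
        (opens_child hN hi hx ho (Finset.mem_range.1 hb) h)
    · exact Finset.sum_nonneg fun r _ => by unfold openInd; split_ifs <;> norm_num

/-! ### Offline schedules adapted to full intervals. -/

/-- All children of the interval of level `j` around `d` are opened, if the interval is. -/
def IsFull (N : ℕ) (D : ℕ → Bool) (d : ℕ) : ℕ → Prop
  | 0 => True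
  | i + 1 => ChildrenOpen N i (d / N ^ (i + 1) * N ^ (i + 1)) (N - 1) D

open Classical in
/-- The highest level of a full interval around `d`. -/
noncomputable def fullLevel (N K : ℕ) (D : ℕ → Bool) (d : ℕ) : ℕ :=
  Nat.findGreatest (IsFull N D d) K

lemma isFull_congr (h : d / N ^ j = e / N ^ j) : IsFull N D d j ↔ IsFull N D e j := by
  cases j with
  | zero => exact Iff.rfl
  | succ j => rw [IsFull, IsFull, h]

lemma fullLevel_le : fullLevel N K D d ≤ K := by
  classical
  exact Nat.findGreatest_le K

lemma isFull_fullLevel : IsFull N D d (fullLevel N K D d) := by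
  classical
  exact Nat.findGreatest_spec (P := IsFull N D d) (Nat.zero_le K) trivial

lemma le_fullLevel (hj : j ≤ K) (h : IsFull N D d j) : j ≤ fullLevel N K D d := by
  classical
  exact Nat.le_findGreatest hj h

/-- Consecutive days share all intervals above the level of the later day. This is the compatibility
required by `opt_le_sum_renewalCost`. -/
lemma fullLevel_const (h : level N K (d + 1) < fullLevel N K D (d + 1)) :
    fullLevel N K D d = fullLevel N K D (d + 1) := by
  have key : ∀ j ≤ K, level N K (d + 1) < j → (IsFull N D d j ↔ IsFull N D (d + 1) j) := by
    intro j hj hlt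
    exact isFull_congr (Nat.succ_div_of_not_dvd ((level_lt_iff hj).1 hlt)).symm
  apply le_antisymm
  · by_contra! hlt
    have := le_fullLevel fullLevel_le
      ((key _ fullLevel_le (h.trans hlt)).1 (isFull_fullLevel (K := K)))
    omega
  · exact le_fullLevel fullLevel_le ((key _ fullLevel_le h).2 isFull_fullLevel)

lemma div_pow_eq_of_lt (hN : 0 < N) {r : ℕ} (hx : N ^ i ∣ x) (hr : r < N ^ i) (hij : i ≤ j) :
    (x + r) / N ^ j = x / N ^ j := by
  obtain ⟨m, rfl⟩ := Nat.exists_eq_add_of_le hij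
  rw [pow_add, ← Nat.div_div_eq_div_mul, ← Nat.div_div_eq_div_mul]
  obtain ⟨c, rfl⟩ := hx
  rw [Nat.mul_add_div (pow_pos hN i), Nat.div_eq_of_lt hr, add_zero,
    Nat.mul_div_cancel_left _ (pow_pos hN i)]

lemma fullLevel_le_of_mem (hN : 0 < N) {r : ℕ} (hx : N ^ i ∣ x) (hr : r < N ^ i)
    (h : fullLevel N K D x ≤ i) : fullLevel N K D (x + r) ≤ i := by
  by_contra! hlt
  have := le_fullLevel fullLevel_le
    ((isFull_congr (div_pow_eq_of_lt hN hx hr hlt.le)).1 (isFull_fullLevel (K := K)))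
  omega

/-- A full interval is renewed only at its start. Otherwise the schedule recurses into the opened
children, and the first child that fails to open costs at most `2`, after which nothing happens
until the interval ends. -/
lemma sum_renewalCost_le_treeCost (hN : 0 < N) : ∀ i x, i ≤ K → N ^ i ∣ x → Opens N K D x →
    fullLevel N K D x ≤ i →
    ∑ r ∈ Finset.range (N ^ i), renewalCost N K D (fullLevel N K D) (x + r) ≤ treeCost N i D x
  | 0, x, _, _, ho, hf => by
    have h0 : fullLevel N K D x = 0 := by omega
    have hc : Continues N K D x := ho.2
    rw [pow_zero, Finset.sum_range_one, add_zero, renewalCost, treeCost,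
      if_pos ⟨ho.1, by omega⟩, if_pos hc, h0]
    norm_num
  | i + 1, x, hi, hx, ho, hf => by
    have hxdiv : x / N ^ (i + 1) * N ^ (i + 1) = x := Nat.div_mul_cancel hx
    have hpos := pow_pos hN (i + 1)
    rw [treeCost]
    split_ifs with hfull
    · have hlev : ∀ r < N ^ (i + 1), fullLevel N K D (x + r) = i + 1 := by
        intro r hr
        refine le_antisymm (fullLevel_le_of_mem hN hx hr hf) (le_fullLevel hi ?_)
        rw [isFull_congr (div_pow_eq_of_lt hN hx hr le_rfl), IsFull, hxdiv]
        exact hfull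
      rw [Finset.sum_eq_single_of_mem 0 (Finset.mem_range.2 hpos)]
      · have hc : Continues N K D x := ho.2
        have h0 := hlev 0 hpos
        rw [add_zero] at h0 ⊢
        rw [renewalCost, if_pos hc]
        split_ifs
        · rw [h0]
        · positivity
      · intro r hr hr0
        have hr := Finset.mem_range.1 hr
        rw [renewalCost, if_neg]
        rintro ⟨-, h⟩
        rw [hlev r hr, le_level_iff hi, Nat.dvd_add_right hx] at h
        have := Nat.le_of_dvd (by omega) h
        omega
    · have hf' : fullLevel N K D x ≤ i := by
        by_contra! hlt
        have h1 := isFull_fullLevel (N := N) (K := K) (D := D) (d := x)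
        rw [show fullLevel N K D x = i + 1 by omega, IsFull, hxdiv] at h1
        exact hfull h1
      have hchild : ∀ b < N, fullLevel N K D (x + b * N ^ i) ≤ i := by
        intro b hb
        by_contra! hlt
        have hbi : b * N ^ i < N ^ (i + 1) := by
          have := child_end_le (i := i) hb
          have := pow_pos hN i
          omega
        have := fullLevel_le_of_mem hN hx hbi hf
        have h1 := isFull_fullLevel (N := N) (K := K) (D := D) (d := x + b * N ^ i)
        rw [show fullLevel N K D (x + b * N ^ i) = i + 1 by omega,
          isFull_congr (div_pow_eq_of_lt hN hx hbi le_rfl), IsFull, hxdiv] at h1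
        exact hfull h1
      have hdvd : ∀ b, N ^ i ∣ x + b * N ^ i := fun b =>
        Nat.dvd_add ((pow_dvd_pow N (Nat.le_succ i)).trans hx) (dvd_mul_left _ _)
      classical
      have hex : ∃ b, ¬ ChildrenOpen N i x b D := ⟨_, hfull⟩
      -- The first child that is not opened; it is not child `0`, which starts with the interval
      -- itself.
      set m := Nat.find hex with hm
      have hmopen : ∀ b < m, ChildrenOpen N i x b D := fun b hb => not_not.1 (Nat.find_min hex hb)
      have hmnot : ¬ ChildrenOpen N i x m D := Nat.find_spec hex
      have hmN : m ≤ N - 1 := Nat.find_min' hex hfull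
      have hm0 : 0 < m := by
        rcases Nat.eq_zero_or_pos m with h0 | h0
        · rw [h0] at hmnot
          exact absurd (by simp [ChildrenOpen, childStarts]) hmnot
        · exact h0
      have hmb : D (x + m * N ^ i) = false := by
        rw [← Bool.not_eq_true]
        intro htrue
        refine hmnot fun e he => ?_
        obtain ⟨c, hc, hcm, rfl⟩ := mem_childStarts.1 he
        rcases hcm.eq_or_lt with rfl | hlt
        · exact htrue
        · exact hmopen c hlt _ (mem_childStarts.2 ⟨c, hc, le_rfl, rfl⟩)
      have hact : IsActive N K D (x + m * N ^ i) := by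
        have h1 := isActive_of_opens hN (hdvd (m - 1)) (by omega)
          (opens_child hN hi hx ho (by omega) (hmopen (m - 1) (by omega)))
        rwa [show x + (m - 1) * N ^ i + N ^ i = x + m * N ^ i by
          rw [add_assoc, ← Nat.succ_mul, Nat.succ_eq_add_one, Nat.sub_add_cancel hm0]] at h1
      have hlev := level_child (K := K) hN hi hx hm0 (show m < N by omega)
      have hnot_cont : ¬ Continues N K D (x + m * N ^ i) := by
        rintro (h | h)
        · rw [hmb] at h; cases h
        · omega
      have hmlt : m * N ^ i < N ^ (i + 1) := by
        have := child_end_le (i := i) (show m < N by omega)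
        have := pow_pos hN i
        omega
      have hnext : nextActive N K D (x + m * N ^ i + 1) = x + N ^ (i + 1) := by
        rw [nextActive_succ_of_stop hact hnot_cont, hlev, div_pow_eq_of_lt hN hx hmlt le_rfl,
          Nat.succ_mul, hxdiv]
      have hquiet : ∀ d, x + m * N ^ i < d → d < x + N ^ (i + 1) →
          renewalCost N K D (fullLevel N K D) d = 0 := by
        intro d hd hd'
        rw [renewalCost, if_neg]
        rintro ⟨h, -⟩
        have := nextActive_eq_of_le (N := N) (K := K) (D := D) (d := x + m * N ^ i + 1) hd (by omega)
        unfold IsActive at h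
        omega
      have hcost_le : renewalCost N K D (fullLevel N K D) (x + m * N ^ i) ≤ 2 := by
        rw [renewalCost, if_neg hnot_cont]
        split_ifs <;> norm_num
      have hterm : ∀ b ∈ Finset.range N,
          ∑ r ∈ Finset.range (N ^ i), renewalCost N K D (fullLevel N K D) (x + (b * N ^ i + r)) ≤
          (if m = b then 2 else 0) +
            if ChildrenOpen N i x b D then treeCost N i D (x + b * N ^ i) else 0 := by
        intro b hb
        have hb := Finset.mem_range.1 hb
        have hend := child_end_le (i := i) hb
        simp only [← add_assoc]
        rcases lt_trichotomy b m with h | h | h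
        · rw [if_neg h.ne', if_pos (hmopen b h), zero_add]
          exact sum_renewalCost_le_treeCost hN i _ (by omega) (hdvd b)
            (opens_child hN hi hx ho hb (hmopen b h)) (hchild b hb)
        · subst h
          rw [if_pos rfl, if_neg hmnot, add_zero,
            Finset.sum_eq_single_of_mem 0 (Finset.mem_range.2 (pow_pos hN i))]
          · rw [add_zero]; exact hcost_le
          · intro r hr hr0
            have := Finset.mem_range.1 hr
            exact hquiet _ (by omega) (by omega)
        · have hlt : m * N ^ i < b * N ^ i := Nat.mul_lt_mul_of_pos_right h (pow_pos hN i)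
          rw [if_neg h.ne, if_neg fun hcon => hmnot (childrenOpen_mono h.le hcon), add_zero,
            Finset.sum_eq_zero]
          intro r hr
          have := Finset.mem_range.1 hr
          exact hquiet _ (by omega) (by omega)
      rw [pow_succ, mul_comm (N ^ i), sum_range_mul_eq fun r =>
        renewalCost N K D (fullLevel N K D) (x + r)]
      refine (Finset.sum_le_sum hterm).trans ?_
      rw [Finset.sum_add_distrib, Finset.sum_ite_eq, if_pos (Finset.mem_range.2 (by omega))]

lemma opt_le_sum_treeCost (hN : 0 < N) (hn : K + 1 < n) :
    opt (K + 1) (weight n K) (requests N hn (R * N ^ K * (K + 2)) D) ≤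
      ∑ a ∈ Finset.range R, treeCost N K D (a * N ^ K) := by
  refine (opt_le_sum_renewalCost (lam := fullLevel N K D) hN hn (fun _ => fullLevel_le)
    fun _ => fullLevel_const).trans ?_
  rw [sum_range_mul_eq]
  exact Finset.sum_le_sum fun a _ => sum_renewalCost_le_treeCost hN K _ le_rfl
    (dvd_mul_left _ _) (opens_mul_pow hN a) fullLevel_le

lemma interval_le (ha : a ∈ Finset.range R) : a * N ^ K + N ^ K ≤ R * N ^ K := by
  rw [← Nat.succ_mul]
  exact Nat.mul_le_mul_right _ (Finset.mem_range.1 ha)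

lemma le_mean_openInd (hN : 0 < N) : R * (2 - (1 / 2) ^ (N - 1)) ^ K ≤
    ∑ d ∈ Finset.range (R * N ^ K), mean (R * N ^ K) (openInd N K · d) := by
  rw [← mean_sum]
  calc (R : ℝ) * (2 - (1 / 2) ^ (N - 1)) ^ K
      = ∑ a ∈ Finset.range R, mean (R * N ^ K) (treeOpenings N K · (a * N ^ K)) := by
        rw [Finset.sum_congr rfl fun a ha => mean_treeOpenings hN K _ (interval_le ha),
          Finset.sum_const, Finset.card_range, nsmul_eq_mul]
    _ = mean (R * N ^ K) (fun D => ∑ a ∈ Finset.range R, treeOpenings N K D (a * N ^ K)) :=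
        (mean_sum _ _).symm
    _ ≤ _ := mean_mono fun D => by
        rw [sum_range_mul_eq]
        exact Finset.sum_le_sum fun a _ =>
          treeOpenings_le hN K _ le_rfl (dvd_mul_left _ _) (opens_mul_pow hN a)

end Tree

/-! ### The randomized lower bound -/

section Integral

variable {n k T : ℕ} {Ω : Type*} [MeasurableSpace Ω] {P : Measure Ω} [IsProbabilityMeasure P]
  {alg : Ω → DetAlg n k}

lemma measurableSet_mem_run
    (hmeas : ∀ past x C, MeasurableSet {ω | (alg ω).serve past x = C})
    (σ : Fin T → Fin n) (t : ℕ) (p : Fin n) : MeasurableSet {ω | p ∈ (alg ω).run σ t} := by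
  cases t with
  | zero => simp [DetAlg.run]
  | succ t =>
    change MeasurableSet {ω | p ∈ if h : t < T then
      (alg ω).serve (history σ t) (obs σ ⟨t, h⟩) else ∅}
    by_cases h : t < T
    · have heq : {ω | p ∈ if h : t < T then (alg ω).serve (history σ t) (obs σ ⟨t, h⟩) else ∅} =
          ⋃ (C : Finset (Fin n)) (_ : p ∈ C),
            {ω | (alg ω).serve (history σ t) (obs σ ⟨t, h⟩) = C} := by
        ext ω
        simp [h]
      rw [heq]
      exact MeasurableSet.iUnion fun C => MeasurableSet.iUnion fun _ => hmeas _ _ C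
    · simp [h]

/-- The cost is a finite combination of indicators of events about the cache contents. -/
lemma integrable_cost (hmeas : ∀ past x C, MeasurableSet {ω | (alg ω).serve past x = C})
    (w : Fin n → ℝ) (σ : Fin T → Fin n) : Integrable (fun ω => (alg ω).cost w σ) P := by
  have heq : (fun ω => (alg ω).cost w σ) = fun ω => ∑ t ∈ Finset.range T, ∑ p : Fin n,
      ({ω | p ∈ (alg ω).run σ t} \ {ω | p ∈ (alg ω).run σ (t + 1)}).indicator
        (fun _ => w p) ω := by
    funext ω
    rw [DetAlg.cost, evictionCost]
    refine Finset.sum_congr rfl fun t _ => ?_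
    refine Finset.sum_subset_zero_on_sdiff (Finset.subset_univ _) (fun p hp => ?_) fun p hp => ?_
    · refine Set.indicator_of_notMem ?_ _
      simpa using hp
    · symm
      apply Set.indicator_of_mem
      simpa using hp
  rw [heq]
  exact integrable_finsetSum _ fun t _ => integrable_finsetSum _ fun p _ =>
    (integrable_const _).indicator
      ((measurableSet_mem_run hmeas σ t p).diff (measurableSet_mem_run hmeas σ (t + 1) p))

end Integral

section Randomized

variable {N K n R : ℕ} {A : RandAlg.{u} n (K + 1)}

lemma mean_integral {Ω : Type*} [MeasurableSpace Ω] {P : Measure Ω} {M : ℕ}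
    {F : (ℕ → Bool) → Ω → ℝ} (hF : ∀ D, Integrable (F D) P) :
    mean M (fun D => ∫ ω, F D ω ∂P) = ∫ ω, mean M (fun D => F D ω) ∂P := by
  simp only [mean]
  rw [integral_div, integral_finsetSum _ fun f _ => hF _]

lemma le_mean_expectedCost (hN : 0 < N) (hn : K + 1 < n) :
    R * (2 - (1 / 2) ^ (N - 1)) ^ K ≤ mean (R * N ^ K)
      (fun D => A.expectedCost (weight n K) (requests N hn (R * N ^ K * (K + 2)) D)) := by
  let _ := A.mΩ
  have := A.isProb
  have hint : ∀ D, Integrable (fun ω => (A.alg ω).cost (weight n K)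
      (requests N hn (R * N ^ K * (K + 2)) D)) A.P := fun D =>
    integrable_cost A.measurableSet_serve _ _
  have h1 : mean (R * N ^ K)
      (fun D => A.expectedCost (weight n K) (requests N hn (R * N ^ K * (K + 2)) D)) =
      ∫ ω, mean (R * N ^ K) (fun D => (A.alg ω).cost (weight n K)
        (requests N hn (R * N ^ K * (K + 2)) D)) ∂A.P := mean_integral hint
  rw [h1]
  have h2 : Integrable (fun ω => mean (R * N ^ K) (fun D => (A.alg ω).cost (weight n K)
      (requests N hn (R * N ^ K * (K + 2)) D))) A.P :=
    (integrable_finsetSum _ fun f _ => hint _).div_const _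
  have h3 := integral_mono (μ := A.P) (integrable_const (R * (2 - (1 / 2 : ℝ) ^ (N - 1)) ^ K)) h2
    fun ω => (le_mean_openInd (K := K) hN).trans (mean_openInd_le_mean_cost hN)
  simpa using h3

/-- Yao's principle for the random bits. -/
lemma RandAlg.IsCompetitive.div_le (hn : K + 1 < n) {r p ν β : ℝ}
    (hA : A.IsCompetitive (weight n K) r) (hN : 0 < N) (hp : p = (1 / 2) ^ (N - 1))
    (hν : ν = 2 - (N + 1) * p) (hν' : 3 / 2 ≤ ν)
    (hβ : β = 2 / (N + 1) * 2 ^ K + 8 * ν ^ K - 6) : (2 - p) ^ K / β ≤ r := by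
  obtain ⟨b, hb⟩ := hA
  have hp1 : p ≤ 1 := by rw [hp]; exact pow_le_one₀ (by norm_num) (by norm_num)
  have hβ0 : 0 < β := by
    have h1 : (1 : ℝ) ≤ ν ^ K := one_le_pow₀ (by linarith)
    have h2 : (0 : ℝ) ≤ 2 / (N + 1) * 2 ^ K := by positivity
    linarith
  refine le_of_unbounded_instances (b := b) (pow_pos (by linarith) K) hβ0 fun R => ?_
  refine ⟨R, mean (R * N ^ K)
    (fun D => opt (K + 1) (weight n K) (requests N hn (R * N ^ K * (K + 2)) D)), le_rfl, ?_, ?_, ?_⟩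
  · rw [← mean_const (M := R * N ^ K) 0]
    exact mean_mono fun D => opt_nonneg weight_pos
  · refine (mean_mono fun D => opt_le_sum_treeCost hN hn).trans ?_
    rw [mean_sum]
    calc _ ≤ ∑ a ∈ Finset.range R, β := Finset.sum_le_sum fun a ha => by
          rw [hβ]
          exact mean_treeCost_le hN hp hν hν' K _ (interval_le ha)
      _ = β * R := by rw [Finset.sum_const, Finset.card_range, nsmul_eq_mul, mul_comm]
  · have h1 := le_mean_expectedCost (R := R) (A := A) hN hn
    have h2 : mean (R * N ^ K)
        (fun D => A.expectedCost (weight n K) (requests N hn (R * N ^ K * (K + 2)) D)) ≤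
        mean (R * N ^ K) (fun D =>
          r * opt (K + 1) (weight n K) (requests N hn (R * N ^ K * (K + 2)) D) + b) :=
      mean_mono fun D => hb _ _
    rw [mean_add, mean_const_mul, mean_const] at h2
    rw [← hp] at h1
    linarith

/-! ### Choice of the number of children. -/

lemma one_sub_pow_mul_le {y : ℝ} (hy : 0 ≤ y) (hy1 : y ≤ 1) (m : ℕ) :
    (1 - y) ^ m * (1 + m * y) ≤ 1 := by
  calc (1 - y) ^ m * (1 + m * y) ≤ (1 - y) ^ m * (1 + y) ^ m :=
        mul_le_mul_of_nonneg_left (one_add_mul_le_pow (by linarith) m)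
          (pow_nonneg (by linarith) m)
    _ = (1 - y ^ 2) ^ m := by rw [← mul_pow]; ring
    _ ≤ 1 := pow_le_one₀ (by nlinarith) (by nlinarith)

lemma RandAlg.IsCompetitive.log_le (hn : K + 1 < n) {r : ℝ}
    (hA : A.IsCompetitive (weight n K) r) : 1 / 1028 * Real.log ((K : ℝ) + 1) ≤ r := by
  set m := Nat.log 2 (K + 1) with hm
  have hm1 : (2 : ℝ) ^ m ≤ K + 1 := by exact_mod_cast Nat.pow_log_le_self 2 (Nat.succ_ne_zero K)
  have hm2 : (K : ℝ) + 1 ≤ 2 ^ (m + 1) := by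
    exact_mod_cast (Nat.lt_pow_succ_log_self one_lt_two (K + 1)).le
  have hlin := succ_le_two_pow m
  have hK0 : (0 : ℝ) ≤ K := Nat.cast_nonneg K
  have hm0 : (0 : ℝ) ≤ m := Nat.cast_nonneg m
  have hq : (0 : ℝ) < 2 ^ m := by positivity
  set p : ℝ := (1 / 2) ^ (m + 5 - 1) with hp
  have hpq : p * 2 ^ m = 1 / 16 := by
    rw [hp, show m + 5 - 1 = m + 4 by omega, pow_add, mul_right_comm, ← mul_pow]
    norm_num
  have hp0 : 0 < p := by positivity
  set L : ℝ := m + 6 with hL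
  have hLp : L * p ≤ 1 / 2 := by nlinarith
  have hcast : ((m + 5 : ℕ) : ℝ) + 1 = L := by push_cast; rw [hL]; ring
  have hKp : (K + 1) * p ≤ 1 / 8 := by
    rw [pow_succ] at hm2
    nlinarith
  have hKp' : 1 / 16 ≤ (K + 1) * p := by nlinarith
  -- This `N` makes `(K + 1) * p` lie between `1 / 16` and `1 / 8`: small enough to keep `(2 - p) ^
  -- K` of order `2 ^ K`, large enough that `(2 - L * p) ^ K` drops by a factor of order `L`.
  have hr := hA.div_le (N := m + 5) (p := p) (ν := 2 - L * p) hn (by omega) hp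
    (by rw [hcast]) (by linarith) rfl
  rw [hcast] at hr
  set y := L * p / 2 with hy
  have hν : (2 - L * p) ^ K = 2 ^ K * (1 - y) ^ K := by
    rw [← mul_pow, hy]; congr 1; ring
  have hμ : (2 : ℝ) ^ K / 2 ≤ (2 - p) ^ K := by
    have h1 : (2 - p) ^ K = 2 ^ K * (1 + -(p / 2)) ^ K := by
      rw [← mul_pow]; congr 1; ring
    have h2 := one_add_mul_le_pow (a := -(p / 2)) (by nlinarith) K
    rw [h1]
    have h3 : (1 : ℝ) / 2 ≤ (1 + -(p / 2)) ^ K := by nlinarith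
    have h4 : (0 : ℝ) < 2 ^ K := by positivity
    nlinarith
  have hy1 : L / 64 ≤ 1 + K * y := by
    have h1 : (1 : ℝ) + K * y = 1 + L * ((K + 1) * p) / 2 - L * p / 2 := by rw [hy]; ring
    rw [h1]
    have h2 : L * (1 / 16) ≤ L * ((K + 1) * p) := mul_le_mul_of_nonneg_left hKp' (by positivity)
    linarith
  have hνK : (2 - L * p) ^ K * L ≤ 64 * 2 ^ K := by
    have h1 := one_sub_pow_mul_le (y := y) (by positivity) (by linarith) K
    have h2 : 0 ≤ (1 - y) ^ K := pow_nonneg (by linarith) K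
    have h3 : (1 - y) ^ K * (L / 64) ≤ 1 := (mul_le_mul_of_nonneg_left hy1 h2).trans h1
    have h4 : (0 : ℝ) < 2 ^ K := by positivity
    rw [hν]
    nlinarith
  have hlog : Real.log ((K : ℝ) + 1) ≤ L := by
    have h1 := Real.log_le_log (by positivity) hm2
    rw [Real.log_pow] at h1
    have h2 := Real.log_two_lt_d9
    push_cast at h1
    nlinarith
  have hL0 : 0 < L := by positivity
  refine le_trans ?_ hr
  have hβ0 : 0 < 2 / L * 2 ^ K + 8 * (2 - L * p) ^ K - 6 := by
    have h1 : (1 : ℝ) ≤ (2 - L * p) ^ K := one_le_pow₀ (by linarith)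
    have h2 : (0 : ℝ) < 2 / L * 2 ^ K := by positivity
    linarith
  rw [le_div_iff₀ hβ0]
  -- Here `514 = 2 + 8 * 64`; the loss of `2` in `hμ` turns it into `1028`.
  have hβ : (2 / L * 2 ^ K + 8 * (2 - L * p) ^ K - 6) * L ≤ 514 * 2 ^ K := by
    have h1 : 2 / L * 2 ^ K * L = 2 * 2 ^ K := by field_simp
    nlinarith
  calc _ ≤ 1 / 1028 * L * (2 / L * 2 ^ K + 8 * (2 - L * p) ^ K - 6) := by
        gcongr
    _ ≤ _ := by linarith

end Randomized

end WeightedPaging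

theorem theorem1 :
    (∃ c : ℝ, 0 < c ∧ ∀ k n : ℕ, 1 ≤ k → k < n →
      ∃ w : Fin n → ℝ, (∀ p, 0 < w p) ∧
        ∀ (A : WeightedPaging.DetAlg n k) (r : ℝ), A.IsCompetitive w r → c * (k : ℝ) ≤ r) ∧
    (∃ c : ℝ, 0 < c ∧ ∀ k n : ℕ, 1 ≤ k → k < n →
      ∃ w : Fin n → ℝ, (∀ p, 0 < w p) ∧
        ∀ (A : WeightedPaging.RandAlg.{u} n k) (r : ℝ),
          A.IsCompetitive w r → c * Real.log (k : ℝ) ≤ r) := by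
  constructor
  · refine ⟨1 / 16, by norm_num, fun k n hk hn => ?_⟩
    obtain ⟨K, rfl⟩ := Nat.exists_eq_add_of_le' hk
    refine ⟨WeightedPaging.weight n K, WeightedPaging.weight_pos, fun A r hA => ?_⟩
    push_cast
    exact hA.le hn
  · refine ⟨1 / 1028, by norm_num, fun k n hk hn => ?_⟩
    obtain ⟨K, rfl⟩ := Nat.exists_eq_add_of_le' hk
    refine ⟨WeightedPaging.weight n K, WeightedPaging.weight_pos, fun A r hA => ?_⟩
    push_cast
    exact hA.log_le hn
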